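/- All spaces are real. For a function $f$ on an open set, $\partial_x f$ is the two-sided directional derivative along $x$, and $\partial^j_{x_1\dots x_j}f:=\partial_{x_j}\big(\partial^{j-1}_{x_1\dots x_{j-1}}f\big)$. If $E,F$ are normed spaces, $E_0$ is a normed space continuously embedded in $E$, and $V\subset E$ is open, then $\mathcal G^n(V,F;E_0)$ is the class of continuous $f:V\to F$ such that, for $j=1,\dots,n$, the derivatives $\partial^j_{x_1\dots x_j}f(v)$ exist for all $v\in V$, $x_1,\dots,x_j\in E_0$, are $j$-linear and separately continuous in $(x_1,\dots,x_j)$, and are continuous in $v$ for fixed $x_1,\dots,x_j$. **Setting.** Let $n\ge 1$, $\alpha\in[0,1)$. Let $X$ be a Banach space, $U\subset X$ open, and let $Y_1\supset Y_2\supset\dots\supset Y_n$ be Banach spaces with norms $|\cdot|_1,\dots,|\cdot|_n$ and continuous embeddings $Y_k\to Y_j$ for $j\le k$. Let $h_1:U\times Y_1\to Y_1$ satisfy $h_1(U\times Y_k)\subset Y_k$ for $k=2,\dots,n$, and let $h_k:U\times Y_k\to Y_k$ be the induced maps. Assume: 1. for $k=1,\dots,n$, $h_k$ is continuous and $|h_k(u,y)-h_k(u,y')|_k\le\alpha|y-y'|_k$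 for all $u\in U$, $y,y'\in Y_k$; 2. for $k=1,\dots,n$, $h_k\in\mathcal G^n(U\times Y_k,Y_k;X\times\{0\})$; 3. for $k=1,\dots,n-1$, $h_k\in\mathcal G^n(U\times Y_k,Y_k;X\times Y_{k+1})$; 4. for $k=1,\dots,n$, $j=0,\dots,n-1$, and every permutation $\sigma$ of $\{1,\dots,j+1\}$, the derivative $\partial^{j+1}_{z_{\sigma(1)}\dots z_{\sigma(j+1)}}h_k(u,y)$ exists for all $u\in U$, $y\in Y_k$, $z_1,\dots,z_j\in X$, $z_{j+1}\in Y_k$, and is jointly continuous in $(u,y,z_1,\dots,z_{j+1})$. (Here $x\in X$ and $y\in Y_k$, used as increments of $h_k$, stand for $(x,0)$ and $(0,y)$.) Let $\varphi:U\to Y_1$ be the fixed-point map, $h_1(u,\varphi(u))=\varphi(u)$. **Statement.** Suppose that there is $M>0$ such that, for all $u\in U$, - $|\partial_y h_k(u,y')|_k\le M|y|_k$ for all $y,y'\in Y_k$, $k=1,\dots,n$; - $|\partial^j_{x_1\dots x_j}h_k(u,y)|_k\le M\prod_{l=1}^j|x_l|_X$ for all $x_1,\dots,x_j\in X$, $y\in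 Y_k$, $j,k=1,\dots,n$; - $|\partial^{j+i}_{x_1\dots x_jy_1\dots y_i}h_k(u,y)|_k\le M\prod_{l=1}^j|x_l|_X\prod_{l=1}^i|y_l|_{k+1}$ for all $x_1,\dots,x_j\in X$, $y\in Y_k$, $y_1,\dots,y_i\in Y_{k+1}$, $k=1,\dots,n-1$, $j\ge0$, $i\ge1$, $2\le j+i\le n$. Then, for $k=1,\dots,n$, $\varphi$ takes values in $Y_{n-k+1}$, as a $Y_{n-k+1}$-valued map it has on $U$ all directional derivatives $\partial^k_{x_1\dots x_k}\varphi$, $x_1,\dots,x_k\in X$, and $$\sup_{\substack{u\in U,\ x_1,\dots,x_k\in X\\ |x_1|_X=\dots=|x_k|_X=1}}|\partial^k_{x_1\dots x_k}\varphi(u)|_{n-k+1}\le C,$$ where $C$ depends only on $\alpha$ and $M$, for the given $n$: it does not depend on $k$, on the spaces $X,Y_1,\dots,Y_n$ and their embeddings, on $U$, or on $h_1$. -/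

import Mathlib

universe u v

section DirectionalDerivatives

variable {E : Type*} [AddCommGroup E] [Module ℝ E]
variable {F : Type*} [NormedAddCommGroup F] [NormedSpace ℝ F]

/-- The iterated directional derivative `∂^j_{x₁ … x_j} f` along the list of increments
`[x₁, …, x_j]`: first differentiate along `x₁`, then along `x₂`, and so on. The values are
meaningful at the points of an open set `U` when `DirDiffOn U f [x₁, …, x_j]` holds; they then
depend only on `f` restricted to `U`. -/
noncomputable def dirDeriv (f : E → F) : List E → E → F
  | [] => f
  | x :: xs => dirDeriv (fun w => lineDeriv ℝ f w x) xs

/-- The iterated directional derivative of `f` along the list of increments `[x₁, …, x_j]`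
exists at every point of `U` (which includes the existence on `U` of `∂^i_{x₁ … x_i} f`
for all `i ≤ j`). -/
def DirDiffOn (U : Set E) (f : E → F) : List E → Prop
  | [] => True
  | x :: xs => (∀ w ∈ U, LineDifferentiableAt ℝ f w x) ∧
      DirDiffOn U (fun w => lineDeriv ℝ f w x) xs

end DirectionalDerivatives

/-- The class `𝒢ⁿ(U, F; E₀)` of continuous functions `f : U → F` which are strongly continuously
Gâteaux differentiable up to order `n` with respect to the space `E₀`, continuously embedded into
`E ⊃ U` through `e`.

For `1 ≤ j ≤ n` and `w ∈ U`, the `j`-th Gâteaux differential at `w` is a `j`-linear map `E₀ʲ → F`,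
continuous in each variable separately, whose value at `(x₁, …, x_j)` is the iterated directional
derivative; and it depends continuously on `w ∈ U` for the topology of pointwise convergence on
`E₀ʲ`. (In the space of `j`-linear maps with this topology, the limits of difference quotients and
the continuity in `w` are exactly those obtained at each fixed `(x₁, …, x_j)`.) -/
structure StrongGateaux {E₀ E F : Type*} [NormedAddCommGroup E₀] [NormedSpace ℝ E₀]
    [NormedAddCommGroup E] [NormedSpace ℝ E] [NormedAddCommGroup F] [NormedSpace ℝ F]
    (n : ℕ) (U : Set E) (e : E₀ →L[ℝ] E) (f : E → F) : Prop where
  continuousOn : ContinuousOn f U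
  exists_deriv : ∀ j, 1 ≤ j → j ≤ n → ∀ x : Fin j → E₀,
    DirDiffOn U f (List.ofFn fun l => e (x l))
  multilinear : ∀ j, 1 ≤ j → j ≤ n → ∀ w ∈ U,
    ∃ Λ : MultilinearMap ℝ (fun _ : Fin j => E₀) F,
      (∀ x : Fin j → E₀, Λ x = dirDeriv f (List.ofFn fun l => e (x l)) w) ∧
      ∀ (x : Fin j → E₀) (l : Fin j), Continuous fun z : E₀ => Λ (Function.update x l z)
  continuousOn_deriv : ∀ j, 1 ≤ j → j ≤ n → ∀ x : Fin j → E₀,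
    ContinuousOn (dirDeriv f (List.ofFn fun l => e (x l))) U

section Contractions

variable {X : Type u} [NormedAddCommGroup X] [NormedSpace ℝ X]
variable {Y : ℕ → Type v} [∀ k, NormedAddCommGroup (Y k)] [∀ k, NormedSpace ℝ (Y k)]

/-- `Y 1 ⊃ Y 2 ⊃ ⋯ ⊃ Y n` is a decreasing sequence of normed spaces with continuous canonical
embeddings `incl j k : Y k → Y j`, for `1 ≤ j ≤ k ≤ n`. Only the indices `1, …, n` matter. -/
structure IsDecreasingScale (n : ℕ) (incl : ∀ j k : ℕ, Y k →L[ℝ] Y j) : Prop where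
  injective : ∀ j k, 1 ≤ j → j ≤ k → k ≤ n → Function.Injective (incl j k)
  refl : ∀ k, 1 ≤ k → k ≤ n → ∀ y : Y k, incl k k y = y
  trans : ∀ i j k, 1 ≤ i → i ≤ j → j ≤ k → k ≤ n →
    ∀ y : Y k, incl i j (incl j k y) = incl i k y

/-- The increments `(x₁, 0), …, (x_j, 0), (0, y)` in the product `A × B`. -/
def mixedIncrements {A B : Type*} [Zero A] [Zero B] {j : ℕ} (x : Fin j → A) (y : B) :
    Fin (j + 1) → A × B :=
  Fin.snoc (α := fun _ => A × B) (fun l => (x l, 0)) (0, y)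

/-- The standing assumption on a parametric `α`-contraction `h 1 : U × Y 1 → Y 1` that leaves
invariant the spaces of the decreasing sequence `Y 1 ⊃ ⋯ ⊃ Y n`, the induced maps being
`h k : U × Y k → Y k`. Values of `h k` outside `U × Y k`, and the indices `k` outside
`{1, …, n}`, are irrelevant. -/
structure ContractionScale (n : ℕ) (α : ℝ) (U : Set X) (incl : ∀ j k : ℕ, Y k →L[ℝ] Y j)
    (h : ∀ k : ℕ, X × Y k → Y k) : Prop where
  isOpen : IsOpen U
  scale : IsDecreasingScale n incl
  /-- `h 1` maps `U × Y k` into `Y k`, and `h k` is the map it induces. -/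
  induced : ∀ k, 1 ≤ k → k ≤ n → ∀ w ∈ U, ∀ y : Y k,
    incl 1 k (h k (w, y)) = h 1 (w, incl 1 k y)
  continuousOn : ∀ k, 1 ≤ k → k ≤ n → ContinuousOn (h k) (U ×ˢ Set.univ)
  contraction : ∀ k, 1 ≤ k → k ≤ n → ∀ w ∈ U, ∀ y y' : Y k,
    ‖h k (w, y) - h k (w, y')‖ ≤ α * ‖y - y'‖
  /-- `h k ∈ 𝒢ⁿ(U × Y k, Y k; X × {0})` -/
  gateaux_left : ∀ k, 1 ≤ k → k ≤ n →
    StrongGateaux n (U ×ˢ Set.univ) (ContinuousLinearMap.inl ℝ X (Y k)) (h k)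
  /-- `h k ∈ 𝒢ⁿ(U × Y k, Y k; X × Y (k + 1))` -/
  gateaux_prod : ∀ k, 1 ≤ k → k + 1 ≤ n →
    StrongGateaux n (U ×ˢ Set.univ)
      ((ContinuousLinearMap.id ℝ X).prodMap (incl k (k + 1))) (h k)
  /-- The derivatives of `h k` along `j` increments in `X` and one increment in `Y k`, taken in
  any order, exist. -/
  exists_mixed : ∀ k, 1 ≤ k → k ≤ n → ∀ j, j + 1 ≤ n →
    ∀ (σ : Equiv.Perm (Fin (j + 1))) (x : Fin j → X) (z : Y k),
      DirDiffOn (U ×ˢ Set.univ) (h k) (List.ofFn fun l => mixedIncrements x z (σ l))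
  /-- These derivatives are jointly continuous in the point and the increments. -/
  continuousOn_mixed : ∀ k, 1 ≤ k → k ≤ n → ∀ j, j + 1 ≤ n →
    ∀ σ : Equiv.Perm (Fin (j + 1)),
      ContinuousOn
        (fun p : (X × Y k) × (Fin j → X) × Y k =>
          dirDeriv (h k) (List.ofFn fun l => mixedIncrements p.2.1 p.2.2 (σ l)) p.1)
        ((U ×ˢ Set.univ) ×ˢ Set.univ)

/-- Uniform bounds, with constant `M`, on the derivatives of the maps `h k`. -/
structure DerivativeBounds (n : ℕ) (M : ℝ) (U : Set X) (incl : ∀ j k : ℕ, Y k →L[ℝ] Y j)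
    (h : ∀ k : ℕ, X × Y k → Y k) : Prop where
  first : ∀ k, 1 ≤ k → k ≤ n → ∀ w ∈ U, ∀ y y' : Y k,
    ‖dirDeriv (h k) [((0 : X), y)] (w, y')‖ ≤ M * ‖y‖
  left : ∀ k, 1 ≤ k → k ≤ n → ∀ j, 1 ≤ j → j ≤ n → ∀ w ∈ U, ∀ (y : Y k) (x : Fin j → X),
    ‖dirDeriv (h k) (List.ofFn fun l => (x l, (0 : Y k))) (w, y)‖ ≤ M * ∏ l, ‖x l‖
  mixed : ∀ k, 1 ≤ k → k + 1 ≤ n → ∀ j i, 1 ≤ i → 2 ≤ j + i → j + i ≤ n →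
    ∀ w ∈ U, ∀ (y : Y k) (x : Fin j → X) (z : Fin i → Y (k + 1)),
      ‖dirDeriv (h k)
          ((List.ofFn fun l => (x l, (0 : Y k))) ++
            (List.ofFn fun l => ((0 : X), incl k (k + 1) (z l)))) (w, y)‖
        ≤ M * (∏ l, ‖x l‖) * ∏ l, ‖z l‖

end Contractions

open Filter Topology Set

/-! ### Directional derivatives along lines and iterated increments. -/

section LineDerivatives

variable {E : Type*} [AddCommGroup E] [Module ℝ E]
variable {F : Type*} [NormedAddCommGroup F] [NormedSpace ℝ F]

/-! Differentiating the fixed-point equation along `x` gives a linear equation `g = A + ∂_g h(u, φ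
u)` for `g = ∂_x φ`, with `A = ∂_x h(u, φ u)`. The map `z ↦ ∂_z h` inherits the Lipschitz constant
`α`, so the equation determines `g` and bounds it by `(1 - α)⁻¹ |A|`. Each further differentiation
reproduces the same equation with a new inhomogeneous term.

The obstacle is that repeated increments in the second variable of `h k` are only allowed in the
smaller space `Y (k + 1)`: the term `∂_g h(u, φ u)` can be differentiated where both `g` and the
velocity of `φ` come from `Y (k + 1)`. Hence each extra order of differentiation costs one space. If
the `Y (k + 1)`-valued fixed point has bounded derivatives of orders `1, …, d + 1`, the `Y k`-valued
one gains order `d + 2` (`derivBdd_succ`, iterated in `derivBdd_fixedPoint`).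

Existence of a derivative is obtained by solving the limiting linear equation for `Δ` with Banach's
theorem and showing that the difference quotients `q` satisfy `|q - Δ| ≤ α |q - Δ| + o(1)`
(`tendsto_of_norm_sub_le`). The `o(1)` terms and the new inhomogeneous terms come from a chain rule
for the derivatives of `h`, as multilinear forms at `(u, φ u)` with increments depending on `u`
(`tendsto_quotient`). Separate continuity of these forms is not enough for it; the uniform bounds in
orders at least 2 turn it into joint continuity (`tendsto_dirDeriv`). The constants are explicit
recursions in `α`, `M` and `n`. Order 1 is controlled by the contraction instead, so no norm of an
embedding enters. -/

theorem dirDeriv_append (f : E → F) (l₁ l₂ : List E) :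
    dirDeriv f (l₁ ++ l₂) = dirDeriv (dirDeriv f l₁) l₂ := by
  induction l₁ generalizing f with
  | nil => rfl
  | cons a l ih => simp only [List.cons_append, dirDeriv, ih]

theorem dirDiffOn_append {U : Set E} {f : E → F} {l₁ l₂ : List E} :
    DirDiffOn U f (l₁ ++ l₂) ↔ DirDiffOn U f l₁ ∧ DirDiffOn U (dirDeriv f l₁) l₂ := by
  induction l₁ generalizing f with
  | nil => simp [DirDiffOn, dirDeriv]
  | cons a l ih => simp only [List.cons_append, DirDiffOn, dirDeriv, ih, and_assoc]

theorem hasLineDerivAt_translate {f : E → F} {w v : E} {s : ℝ}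
    (hf : LineDifferentiableAt ℝ f (w + s • v) v) :
    HasDerivAt (fun t : ℝ => f (w + t • v)) (lineDeriv ℝ f (w + s • v) v) s := by
  have h1 := hf.hasLineDerivAt
  unfold HasLineDerivAt at h1
  have h2 : HasDerivAt (fun t : ℝ => t - s) 1 s := by
    simpa using (hasDerivAt_id s).sub_const s
  have h1' : HasDerivAt (fun t : ℝ => f (w + s • v + t • v)) (lineDeriv ℝ f (w + s • v) v)
      (s - s) := by simpa using h1
  have h3 := HasDerivAt.scomp (h := fun t : ℝ => t - s) s h1' h2
  simp only [one_smul] at h3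
  refine h3.congr_of_eventuallyEq (Eventually.of_forall fun t => ?_)
  simp only [Function.comp]
  congr 1
  rw [add_assoc, ← add_smul]; congr 2; ring

/-- Mean value inequality along a segment. -/
theorem norm_sub_sub_le_of_lineDeriv {f : E → F} {w v : E} {c : F} {C : ℝ}
    (hf : ∀ s ∈ Icc (0 : ℝ) 1, LineDifferentiableAt ℝ f (w + s • v) v)
    (hb : ∀ s ∈ Icc (0 : ℝ) 1, ‖lineDeriv ℝ f (w + s • v) v - c‖ ≤ C) :
    ‖f (w + v) - f w - c‖ ≤ C := by
  have h := norm_image_sub_le_of_norm_deriv_le_segment_01'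
    (f := fun t : ℝ => f (w + t • v) - t • c)
    (f' := fun t => lineDeriv ℝ f (w + t • v) v - c) (C := C)
    (fun t ht => by
      have h1 := (hasLineDerivAt_translate (hf t ht)).sub ((hasDerivAt_id t).smul_const c)
      rw [one_smul] at h1
      exact h1.hasDerivWithinAt)
    (fun t ht => hb t ⟨ht.1, ht.2.le⟩)
  simpa [sub_right_comm] using h

theorem hasLineDerivAt_iff_tendsto {f : E → F} {w v : E} {c : F} :
    HasLineDerivAt ℝ f c w v ↔
      Tendsto (fun t : ℝ => t⁻¹ • (f (w + t • v) - f w)) (𝓝[≠] 0) (𝓝 c) :=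
  hasLineDerivAt_iff_tendsto_slope_zero

theorem LineDifferentiableAt.tendsto {f : E → F} {w v : E} (h : LineDifferentiableAt ℝ f w v) :
    Tendsto (fun t : ℝ => f (w + t • v)) (𝓝 0) (𝓝 (f w)) := by
  have := (DifferentiableAt.continuousAt (𝕜 := ℝ) h).tendsto
  simpa using this

end LineDerivatives

/-! ### Symmetry of second derivatives and moving difference quotients. -/

section OpenSets

variable {E : Type*} [NormedAddCommGroup E] [NormedSpace ℝ E]
variable {F : Type*} [NormedAddCommGroup F] [NormedSpace ℝ F]

theorem tendsto_add_smul_nhds_zero (w v : E) :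
    Tendsto (fun t : ℝ => w + t • v) (𝓝 0) (𝓝 w) := by
  have : ContinuousAt (fun t : ℝ => w + t • v) 0 := by fun_prop
  simpa using this.tendsto

theorem lineDeriv_congr_of_eqOn {V : Set E} (hV : IsOpen V) {f g : E → F} (h : EqOn f g V)
    {w : E} (hw : w ∈ V) (v : E) : lineDeriv ℝ f w v = lineDeriv ℝ g w v :=
  (h.eventuallyEq_of_mem (hV.mem_nhds hw)).lineDeriv_eq

theorem lineDifferentiableAt_congr_of_eqOn {V : Set E} (hV : IsOpen V) {f g : E → F}
    (h : EqOn f g V) {w : E} (hw : w ∈ V) {v : E} (hf : LineDifferentiableAt ℝ f w v) :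
    LineDifferentiableAt ℝ g w v :=
  (h.eventuallyEq_of_mem (hV.mem_nhds hw)).lineDifferentiableAt_iff.1 hf

theorem dirDeriv_congr {V : Set E} (hV : IsOpen V) {f g : E → F} (h : EqOn f g V) (l : List E) :
    EqOn (dirDeriv f l) (dirDeriv g l) V := by
  induction l generalizing f g with
  | nil => exact h
  | cons a l ih => exact ih fun w hw => lineDeriv_congr_of_eqOn hV h hw a

theorem HasLineDerivAt.comp_add {f : E → F} {w v c : E} {f' : F}
    (h : HasLineDerivAt ℝ f f' (w + c) v) : HasLineDerivAt ℝ (fun y => f (y + c)) f' w v := by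
  unfold HasLineDerivAt at h ⊢
  simpa only [add_right_comm w] using h

theorem HasLineDerivAt.sub_fun {f g : E → F} {w v : E} {f' g' : F}
    (hf : HasLineDerivAt ℝ f f' w v) (hg : HasLineDerivAt ℝ g g' w v) :
    HasLineDerivAt ℝ (fun y => f y - g y) (f' - g') w v :=
  HasDerivAt.sub hf hg

/-- Second differences are approximated by the second directional derivative. -/
theorem norm_second_difference_sub_le {f : E → F} {V : Set E} {w a b : E} {c : F} {ε s : ℝ}
    (hs : 0 ≤ s)
    (hV : ∀ σ ∈ Icc (0 : ℝ) 1, ∀ τ ∈ Icc (0 : ℝ) 1, w + τ • (s • a) + σ • (s • b) ∈ V)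
    (ha : ∀ y ∈ V, LineDifferentiableAt ℝ f y a)
    (hab : ∀ y ∈ V, LineDifferentiableAt ℝ (fun y => lineDeriv ℝ f y a) y b)
    (hc : ∀ σ ∈ Icc (0 : ℝ) 1, ∀ τ ∈ Icc (0 : ℝ) 1,
      ‖lineDeriv ℝ (fun y => lineDeriv ℝ f y a) (w + τ • (s • a) + σ • (s • b)) b - c‖ ≤ ε) :
    ‖(f (w + s • a + s • b) - f (w + s • a)) - (f (w + s • b) - f w) - (s * s) • c‖
      ≤ s * s * ε := by
  have key : ∀ τ ∈ Icc (0 : ℝ) 1,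
      HasLineDerivAt ℝ (fun y => f (y + s • b) - f y)
        (s • (lineDeriv ℝ f (w + τ • (s • a) + s • b) a - lineDeriv ℝ f (w + τ • (s • a)) a))
        (w + τ • (s • a)) (s • a) := by
    intro τ hτ
    have h0 := hV 0 (by simp) τ hτ
    have h1 := hV 1 (by simp) τ hτ
    simp only [zero_smul, add_zero, one_smul] at h0 h1
    exact (HasLineDerivAt.sub_fun (ha _ h1).hasLineDerivAt.comp_add
      (ha _ h0).hasLineDerivAt).smul s
  -- The mean value inequality is used twice: along `a` for the increment in `b`, then along `b` for
  -- the derivative in `a`.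
  refine norm_sub_sub_le_of_lineDeriv (f := fun y => f (y + s • b) - f y) (w := w) (v := s • a)
    (fun τ hτ => (key τ hτ).lineDifferentiableAt) fun τ hτ => ?_
  rw [(key τ hτ).lineDeriv, mul_smul, ← smul_sub, norm_smul, Real.norm_of_nonneg hs, mul_assoc]
  refine mul_le_mul_of_nonneg_left ?_ hs
  refine norm_sub_sub_le_of_lineDeriv (f := fun y => lineDeriv ℝ f y a)
    (fun σ hσ => (hab _ (hV σ hσ τ hτ)).smul s) fun σ hσ => ?_
  rw [lineDeriv_smul, ← smul_sub, norm_smul, Real.norm_of_nonneg hs]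
  exact mul_le_mul_of_nonneg_left (hc σ hσ τ hτ) hs

theorem eventually_segments_mem {P : E → Prop} {w : E} (h : ∀ᶠ y in 𝓝 w, P y) (a b : E) :
    ∀ᶠ s in 𝓝[>] (0 : ℝ), ∀ σ ∈ Icc (0 : ℝ) 1, ∀ τ ∈ Icc (0 : ℝ) 1,
      P (w + τ • (s • a) + σ • (s • b)) := by
  obtain ⟨δ, hδ, hball⟩ := Metric.eventually_nhds_iff.1 h
  have h1 : Tendsto (fun s : ℝ => |s| * (‖a‖ + ‖b‖)) (𝓝[>] 0) (𝓝 0) := by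
    have : ContinuousAt (fun s : ℝ => |s| * (‖a‖ + ‖b‖)) 0 := by fun_prop
    simpa using this.tendsto.mono_left nhdsWithin_le_nhds
  filter_upwards [h1.eventually_lt_const hδ] with s hs σ hσ τ hτ
  apply hball
  rw [dist_eq_norm]
  calc ‖w + τ • (s • a) + σ • (s • b) - w‖ = ‖τ • (s • a) + σ • (s • b)‖ := by
        congr 1; abel
    _ ≤ |τ| * (|s| * ‖a‖) + |σ| * (|s| * ‖b‖) := by
        refine (norm_add_le _ _).trans ?_
        simp only [norm_smul, Real.norm_eq_abs]; rfl
    _ ≤ 1 * (|s| * ‖a‖) + 1 * (|s| * ‖b‖) := by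
        gcongr
        · rw [abs_of_nonneg hτ.1]; exact hτ.2
        · rw [abs_of_nonneg hσ.1]; exact hσ.2
    _ = |s| * (‖a‖ + ‖b‖) := by ring
    _ < δ := hs

/-- Symmetry of continuous second directional derivatives. -/
theorem lineDeriv_lineDeriv_comm {f : E → F} {V : Set E} (hV : IsOpen V) {w a b : E}
    (hw : w ∈ V) (ha : ∀ y ∈ V, LineDifferentiableAt ℝ f y a)
    (hb : ∀ y ∈ V, LineDifferentiableAt ℝ f y b)
    (hab : ∀ y ∈ V, LineDifferentiableAt ℝ (fun y => lineDeriv ℝ f y a) y b)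
    (hba : ∀ y ∈ V, LineDifferentiableAt ℝ (fun y => lineDeriv ℝ f y b) y a)
    (cab : ContinuousOn (fun y => lineDeriv ℝ (fun y => lineDeriv ℝ f y a) y b) V)
    (cba : ContinuousOn (fun y => lineDeriv ℝ (fun y => lineDeriv ℝ f y b) y a) V) :
    lineDeriv ℝ (fun y => lineDeriv ℝ f y a) w b = lineDeriv ℝ (fun y => lineDeriv ℝ f y b) w a := by
  set c := lineDeriv ℝ (fun y => lineDeriv ℝ f y a) w b with hc
  set d := lineDeriv ℝ (fun y => lineDeriv ℝ f y b) w a with hd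
  refine eq_of_forall_dist_le fun ε hε => ?_
  have near : ∀ {g : E → F}, ContinuousOn g V → ∀ᶠ y in 𝓝 w, y ∈ V ∧ ‖g y - g w‖ ≤ ε / 2 := by
    intro g hg
    have h1 := (hg.continuousAt (hV.mem_nhds hw)).tendsto
    filter_upwards [hV.mem_nhds hw, Metric.tendsto_nhds.1 h1 (ε / 2) (by positivity)]
      with y hy hy'
    exact ⟨hy, by rw [← dist_eq_norm]; exact hy'.le⟩
  obtain ⟨s, ⟨h1, h2⟩, hs⟩ := ((eventually_segments_mem (near cab) a b).and
    (eventually_segments_mem (near cba) b a)).and self_mem_nhdsWithin |>.exists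
  have hs' : (0 : ℝ) < s := hs
  have e1 := norm_second_difference_sub_le (c := c) hs'.le
    (fun σ hσ τ hτ => (h1 σ hσ τ hτ).1) ha hab (fun σ hσ τ hτ => (h1 σ hσ τ hτ).2)
  have e2 := norm_second_difference_sub_le (c := d) hs'.le
    (fun σ hσ τ hτ => (h2 σ hσ τ hτ).1) hb hba (fun σ hσ τ hτ => (h2 σ hσ τ hτ).2)
  -- The second difference of `f` is symmetric in `a` and `b`, so it cancels and leaves only the two
  -- errors.
  have e3 : (s * s) • (c - d) =
      ((f (w + s • b + s • a) - f (w + s • b)) - (f (w + s • a) - f w) - (s * s) • d) -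
      ((f (w + s • a + s • b) - f (w + s • a)) - (f (w + s • b) - f w) - (s * s) • c) := by
    rw [add_right_comm w (s • b) (s • a), smul_sub]; abel
  have e4 : s * s * ‖c - d‖ ≤ s * s * ε := by
    have := norm_sub_le_of_le e2 e1
    rw [← e3, norm_smul, Real.norm_of_nonneg (by positivity)] at this
    linarith
  rw [dist_eq_norm]
  exact le_of_mul_le_mul_left e4 (by positivity)

/-- Difference quotients along moving base points and moving directions. -/
theorem tendsto_difference_quotient {E₀ : Type*} [NormedAddCommGroup E₀] [NormedSpace ℝ E₀]
    {e : E₀ →L[ℝ] E} {f : E → F} {V : Set E} (hV : IsOpen V) {w₀ : E} (hw₀ : w₀ ∈ V) {v₀ : E₀}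
    (hf : ∀ w ∈ V, ∀ v, LineDifferentiableAt ℝ f w (e v))
    (hc : Tendsto (fun p : E × E₀ => lineDeriv ℝ f p.1 (e p.2)) (𝓝 w₀ ×ˢ 𝓝 v₀)
      (𝓝 (lineDeriv ℝ f w₀ (e v₀))))
    {w : ℝ → E} {v : ℝ → E₀} (hw : Tendsto w (𝓝[≠] 0) (𝓝 w₀))
    (hv : Tendsto v (𝓝[≠] 0) (𝓝 v₀)) :
    Tendsto (fun t : ℝ => t⁻¹ • (f (w t + t • e (v t)) - f (w t))) (𝓝[≠] 0)
      (𝓝 (lineDeriv ℝ f w₀ (e v₀))) := by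
  rw [Metric.tendsto_nhds]
  intro ε hε
  have h1 : ∀ᶠ p : E × E₀ in 𝓝 w₀ ×ˢ 𝓝 v₀,
      p.1 ∈ V ∧ ‖lineDeriv ℝ f p.1 (e p.2) - lineDeriv ℝ f w₀ (e v₀)‖ ≤ ε / 2 := by
    filter_upwards [(tendsto_fst (f := 𝓝 w₀) (g := 𝓝 v₀)).eventually (hV.mem_nhds hw₀),
      Metric.tendsto_nhds.1 hc (ε / 2) (by positivity)] with p hp hp'
    exact ⟨hp, by rw [← dist_eq_norm]; exact hp'.le⟩
  obtain ⟨P, hP, Q, hQ, hPQ⟩ := eventually_prod_iff.1 h1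
  obtain ⟨δ, hδ, hball⟩ := Metric.eventually_nhds_iff.1 hP
  have ht0 : Tendsto (fun t : ℝ => t) (𝓝[≠] 0) (𝓝 0) := nhdsWithin_le_nhds
  have hwt : Tendsto (fun t : ℝ => ‖w t - w₀‖ + |t| * ‖e (v t)‖) (𝓝[≠] 0) (𝓝 0) := by
    have a1 : Tendsto (fun t : ℝ => ‖w t - w₀‖) (𝓝[≠] 0) (𝓝 0) := by
      simpa using (hw.sub_const w₀).norm
    have a2 : Tendsto (fun t : ℝ => |t| * ‖e (v t)‖) (𝓝[≠] 0) (𝓝 (0 * ‖e v₀‖)) := by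
      have a3 : Tendsto (fun t : ℝ => |t|) (𝓝[≠] 0) (𝓝 0) := by
        simpa using ht0.abs
      exact a3.mul ((e.continuous.tendsto v₀).comp hv).norm
    simpa using a1.add a2
  filter_upwards [hwt.eventually_lt_const hδ, hv.eventually hQ, self_mem_nhdsWithin]
    with t ht hQt htne
  have htne' : t ≠ 0 := htne
  -- The whole segment of the difference quotient stays where the derivative along `v t` is `ε /
  -- 2`-close to its limit.
  have hseg : ∀ s ∈ Icc (0 : ℝ) 1, P (w t + s • t • e (v t)) := by
    intro s hs
    apply hball
    rw [dist_eq_norm]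
    calc ‖w t + s • t • e (v t) - w₀‖ = ‖(w t - w₀) + s • t • e (v t)‖ := by congr 1; abel
      _ ≤ ‖w t - w₀‖ + |s| * (|t| * ‖e (v t)‖) := by
        refine (norm_add_le _ _).trans ?_
        simp only [norm_smul, Real.norm_eq_abs]; rfl
      _ ≤ ‖w t - w₀‖ + 1 * (|t| * ‖e (v t)‖) := by
        gcongr
        rw [abs_of_nonneg hs.1]; exact hs.2
      _ < δ := by rwa [one_mul]
  have hmv := norm_sub_sub_le_of_lineDeriv (f := f) (w := w t) (v := t • e (v t))
    (c := t • lineDeriv ℝ f w₀ (e v₀)) (C := |t| * (ε / 2))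
    (fun s hs => (hf _ (hPQ (hseg s hs) hQt).1 _).smul t)
    (fun s hs => by
      rw [lineDeriv_smul, ← smul_sub, norm_smul, Real.norm_eq_abs]
      exact mul_le_mul_of_nonneg_left (hPQ (hseg s hs) hQt).2 (abs_nonneg t))
  have h2 : t⁻¹ • (f (w t + t • e (v t)) - f (w t)) - lineDeriv ℝ f w₀ (e v₀) =
      t⁻¹ • (f (w t + t • e (v t)) - f (w t) - t • lineDeriv ℝ f w₀ (e v₀)) := by
    rw [smul_sub t⁻¹ (f (w t + t • e (v t)) - f (w t)), inv_smul_smul₀ htne']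
  rw [dist_eq_norm, h2, norm_smul, norm_inv, Real.norm_eq_abs]
  have h3 : 0 < |t| := abs_pos.2 htne'
  calc |t|⁻¹ * _ ≤ |t|⁻¹ * (|t| * (ε / 2)) := by gcongr
    _ = ε / 2 := by field_simp
    _ < ε := by linarith

/-! ### Strong Gâteaux differentiability in terms of lists. -/

theorem ofFn_comp_get {A B : Type*} (g : A → B) (l : List A) :
    List.ofFn (fun i => g (l.get i)) = l.map g := by
  rw [show (fun i => g (l.get i)) = g ∘ l.get from rfl, ← List.map_ofFn, List.ofFn_get]

/-- The class `𝒢ⁿ(V, F; E₀)` in terms of lists of increments. -/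
structure ListGateaux {E₀ : Type*} [NormedAddCommGroup E₀] [NormedSpace ℝ E₀]
    (n : ℕ) (V : Set E) (e : E₀ →L[ℝ] E) (f : E → F) : Prop where
  exists_deriv : ∀ l : List E₀, l.length ≤ n → DirDiffOn V f (l.map e)
  continuousOn : ∀ l : List E₀, l.length ≤ n → ContinuousOn (dirDeriv f (l.map e)) V
  add : ∀ (a b : E₀) (l : List E₀), l.length + 1 ≤ n → ∀ w ∈ V,
    dirDeriv f (((a + b) :: l).map e) w =
      dirDeriv f ((a :: l).map e) w + dirDeriv f ((b :: l).map e) w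
  smul : ∀ (c : ℝ) (a : E₀) (l : List E₀), l.length + 1 ≤ n → ∀ w ∈ V,
    dirDeriv f (((c • a) :: l).map e) w = c • dirDeriv f ((a :: l).map e) w

/-- Lists of increments permit induction by consing and appending. Linearity is kept in the first
slot only, since symmetry transports it to the others. -/
theorem StrongGateaux.listGateaux {E₀ : Type*} [NormedAddCommGroup E₀] [NormedSpace ℝ E₀]
    {n : ℕ} {V : Set E} {e : E₀ →L[ℝ] E} {f : E → F} (h : StrongGateaux n V e f) :
    ListGateaux n V e f := by
  have hl : ∀ l : List E₀, List.ofFn (fun i => e (l.get i)) = l.map e := ofFn_comp_get e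
  have hcons : ∀ (a : E₀) (l : List E₀),
      List.ofFn (fun i => e ((Fin.cons a l.get : Fin (l.length + 1) → E₀) i)) =
        (a :: l).map e := fun a l => by
    rw [List.ofFn_succ]
    exact congrArg (e a :: ·) (hl l)
  constructor
  · intro l hln
    rcases Nat.eq_zero_or_pos l.length with h0 | h0
    · rw [List.length_eq_zero_iff.1 h0]; trivial
    · rw [← hl]; exact h.exists_deriv _ h0 hln _
  · intro l hln
    rcases Nat.eq_zero_or_pos l.length with h0 | h0
    · rw [List.length_eq_zero_iff.1 h0]; exact h.continuousOn
    · rw [← hl]; exact h.continuousOn_deriv _ h0 hln _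
  · intro a b l hln w hw
    obtain ⟨Λ, hΛ, -⟩ := h.multilinear (l.length + 1) (by omega) hln w hw
    simp only [← hcons, ← hΛ, Λ.cons_add]
  · intro c a l hln w hw
    obtain ⟨Λ, hΛ, -⟩ := h.multilinear (l.length + 1) (by omega) hln w hw
    simp only [← hcons, ← hΛ, Λ.cons_smul]

namespace ListGateaux

variable {E₀ : Type*} [NormedAddCommGroup E₀] [NormedSpace ℝ E₀]
variable {n : ℕ} {V : Set E} {e : E₀ →L[ℝ] E} {f : E → F}

/-- Adjacent transpositions generate all permutations, and each of them is the symmetry of second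
derivatives of a lower-order derivative. -/
theorem perm (h : ListGateaux n V e f) (hV : IsOpen V) {l₁ l₂ : List E₀} (hp : l₁.Perm l₂)
    (hl : l₁.length ≤ n) : EqOn (dirDeriv f (l₁.map e)) (dirDeriv f (l₂.map e)) V := by
  -- The order and the function vary because a common head `a` replaces `f` by `∂_a f` and `n` by `n
  -- - 1`; only existence and continuity need to survive this.
  have main : ∀ (n : ℕ) (f : E → F), (∀ l : List E₀, l.length ≤ n → DirDiffOn V f (l.map e)) →
      (∀ l : List E₀, l.length ≤ n → ContinuousOn (dirDeriv f (l.map e)) V) →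
      l₁.length ≤ n → EqOn (dirDeriv f (l₁.map e)) (dirDeriv f (l₂.map e)) V := by
    clear hl
    induction hp with
    | nil => exact fun n f _ _ _ => eqOn_refl _ _
    | cons a hp ih =>
      intro n f hd hc hl
      obtain ⟨n, rfl⟩ : ∃ m, n = m + 1 := ⟨n - 1, by simp at hl; omega⟩
      exact ih n (fun w => lineDeriv ℝ f w (e a))
        (fun l hl' => (hd (a :: l) (by simpa using hl')).2)
        (fun l hl' => hc (a :: l) (by simpa using hl')) (by simpa using hl)
    | swap a b l =>
      intro n f hd hc hl
      refine dirDeriv_congr hV (fun w hw => ?_) (l.map e)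
      have h2 : 2 ≤ n := by simp at hl; omega
      have dab := hd [a, b] h2
      have dba := hd [b, a] h2
      exact lineDeriv_lineDeriv_comm hV hw dba.1 dab.1 dba.2.1 dab.2.1 (hc [b, a] h2) (hc [a, b] h2)
    | trans h1 h2 ih1 ih2 =>
      intro n f hd hc hl
      exact (ih1 n f hd hc hl).trans (ih2 n f hd hc (h1.length_eq ▸ hl))
  exact main n f h.exists_deriv h.continuousOn hl

theorem add_mid (h : ListGateaux n V e f) (hV : IsOpen V) (l₁ l₂ : List E₀) (a b : E₀)
    (hl : l₁.length + l₂.length + 1 ≤ n) {w : E} (hw : w ∈ V) :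
    dirDeriv f ((l₁ ++ (a + b) :: l₂).map e) w =
      dirDeriv f ((l₁ ++ a :: l₂).map e) w + dirDeriv f ((l₁ ++ b :: l₂).map e) w := by
  rw [h.perm hV List.perm_middle (by simp; omega) hw, h.perm hV List.perm_middle (by simp; omega) hw,
    h.perm hV List.perm_middle (by simp; omega) hw, h.add _ _ _ (by simp; omega) w hw]

theorem smul_mid (h : ListGateaux n V e f) (hV : IsOpen V) (l₁ l₂ : List E₀) (c : ℝ) (a : E₀)
    (hl : l₁.length + l₂.length + 1 ≤ n) {w : E} (hw : w ∈ V) :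
    dirDeriv f ((l₁ ++ (c • a) :: l₂).map e) w = c • dirDeriv f ((l₁ ++ a :: l₂).map e) w := by
  rw [h.perm hV List.perm_middle (by simp; omega) hw, h.perm hV List.perm_middle (by simp; omega) hw,
    h.smul _ _ _ (by simp; omega) w hw]

theorem sub_mid (h : ListGateaux n V e f) (hV : IsOpen V) (l₁ l₂ : List E₀) (a b : E₀)
    (hl : l₁.length + l₂.length + 1 ≤ n) {w : E} (hw : w ∈ V) :
    dirDeriv f ((l₁ ++ (a - b) :: l₂).map e) w =
      dirDeriv f ((l₁ ++ a :: l₂).map e) w - dirDeriv f ((l₁ ++ b :: l₂).map e) w := by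
  rw [eq_sub_iff_add_eq, ← h.add_mid hV l₁ l₂ (a - b) b hl hw, sub_add_cancel]

theorem lineDifferentiableAt (h : ListGateaux n V e f) (l : List E₀) (hl : l.length + 1 ≤ n)
    (a : E₀) {w : E} (hw : w ∈ V) : LineDifferentiableAt ℝ (dirDeriv f (l.map e)) w (e a) := by
  have := h.exists_deriv (l ++ [a]) (by simpa using hl)
  rw [List.map_append, dirDiffOn_append] at this
  exact this.2.1 w hw

theorem lineDeriv_eq (l : List E₀) (a : E₀) (w : E) :
    lineDeriv ℝ (dirDeriv f (l.map e)) w (e a) = dirDeriv f ((l ++ [a]).map e) w := by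
  rw [List.map_append, dirDeriv_append]; rfl

end ListGateaux

end OpenSets

/-! ### Joint continuity and the chain rule for multilinear derivatives. -/

section ChainRule

theorem prod_norm_nonneg {G : Type*} [SeminormedAddCommGroup G] (l : List G) :
    0 ≤ (l.map norm).prod := by
  refine List.prod_nonneg fun a ha => ?_
  obtain ⟨g, -, rfl⟩ := List.mem_map.1 ha
  exact norm_nonneg g

theorem tendsto_prod_norm {G : Type*} [SeminormedAddCommGroup G] {τ : Type*} {L : Filter τ} (zs : List ((τ → G) × G))
    (hzs : ∀ p ∈ zs, Tendsto p.1 L (𝓝 p.2)) :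
    Tendsto (fun t => (zs.map fun p => ‖p.1 t‖).prod) L (𝓝 (zs.map fun p => ‖p.2‖).prod) := by
  induction zs with
  | nil => exact tendsto_const_nhds
  | cons p zs ih =>
    simp only [List.map_cons, List.prod_cons]
    exact (hzs p (by simp)).norm.mul (ih fun q hq => hzs q (by simp [hq]))

variable {E : Type*} [NormedAddCommGroup E] [NormedSpace ℝ E]
variable {F : Type*} [NormedAddCommGroup F] [NormedSpace ℝ F]
variable {E₀ : Type*} [NormedAddCommGroup E₀] [NormedSpace ℝ E₀]
variable {X : Type*} [NormedAddCommGroup X] [NormedSpace ℝ X]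

/-- The multilinear form `D` given by the directional derivatives of `f` of orders `2, …, n` is
bounded by `c`, uniformly on `V`. -/
def UniformlyBoundedDerivs (n : ℕ) (c : ℝ) (V : Set E) (e : E₀ →L[ℝ] E) (f : E → F) : Prop :=
  ∀ l : List E₀, 2 ≤ l.length → l.length ≤ n → ∀ w ∈ V,
    ‖dirDeriv f (l.map e) w‖ ≤ c * (l.map norm).prod

/-- The directional derivatives of a function along the given lists of functions, one of which is
replaced by its derivative along `x`. -/
noncomputable def slotDerivs (x : X) : List (X → E₀) → List (List (X → E₀))
  | [] => []
  | z :: zs => ((fun u => lineDeriv ℝ z u x) :: zs) :: (slotDerivs x zs).map (z :: ·)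

variable {n : ℕ} {c : ℝ} {V : Set E} {e : E₀ →L[ℝ] E} {f : E → F}

/-- Joint continuity of the derivatives in the point and the increments. -/
theorem ListGateaux.tendsto_dirDeriv (h : ListGateaux n V e f) (hV : IsOpen V)
    (hB : UniformlyBoundedDerivs n c V e f) {τ : Type*} {L : Filter τ} {w : τ → E} {w₀ : E}
    (hw₀ : w₀ ∈ V) (hw : Tendsto w L (𝓝 w₀)) (zs : List ((τ → E₀) × E₀))
    (hzs : ∀ p ∈ zs, Tendsto p.1 L (𝓝 p.2)) (pre : List E₀) (h2 : 2 ≤ pre.length + zs.length)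
    (hn : pre.length + zs.length ≤ n) :
    Tendsto (fun t => dirDeriv f ((pre ++ zs.map fun p => p.1 t).map e) (w t)) L
      (𝓝 (dirDeriv f ((pre ++ zs.map Prod.snd).map e) w₀)) := by
  induction zs generalizing pre with
  | nil =>
    simp only [List.map_nil, List.append_nil]
    exact ((h.continuousOn pre (by simpa using hn)).continuousAt (hV.mem_nhds hw₀)).tendsto.comp hw
  | cons p zs ih =>
    simp only [List.length_cons] at h2 hn
    have h1 := ih (fun q hq => hzs q (by simp [hq])) (pre ++ [p.2]) (by simp; omega)
      (by simp; omega)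
    -- Freezing one increment at its limit costs a form with the entry `p.1 t - p.2`, which the
    -- uniform bound sends to zero.
    have h0 : Tendsto (fun t => dirDeriv f
        ((pre ++ (p.1 t - p.2) :: zs.map fun p => p.1 t).map e) (w t)) L (𝓝 0) := by
      have hp : Tendsto (fun t => p.1 t - p.2) L (𝓝 0) := by
        simpa using (hzs p (by simp)).sub_const p.2
      have hb : Tendsto (fun t => c * ((pre.map norm).prod * (‖p.1 t - p.2‖ *
          (zs.map fun p => ‖p.1 t‖).prod))) L (𝓝 0) := by
        have := ((hp.norm.mul (tendsto_prod_norm zs fun q hq => hzs q (by simp [hq]))).const_mul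
          (pre.map norm).prod).const_mul c
        simpa using this
      refine squeeze_zero_norm' ?_ hb
      filter_upwards [hw (hV.mem_nhds hw₀)] with t ht
      refine (hB _ (by simp; omega) (by simp; omega) _ ht).trans_eq ?_
      simp [List.map_map, Function.comp_def]
    have hsum := h1.add h0
    rw [add_zero] at hsum
    simp only [List.append_assoc, List.singleton_append] at hsum
    refine (tendsto_congr' ?_).1 hsum
    filter_upwards [hw (hV.mem_nhds hw₀)] with t ht
    rw [← h.add_mid hV _ _ _ _ (by simp; omega) ht, add_sub_cancel, List.map_cons]

/-- Derivative of an iterated directional derivative along a curve, with fixed increments. -/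
theorem ListGateaux.tendsto_quotient_const (h : ListGateaux n V e f) (hV : IsOpen V)
    (hB : UniformlyBoundedDerivs n c V e f) {w : ℝ → E} {w₀ : E} {v : ℝ → E₀} {v₀ : E₀}
    (hw₀ : w₀ ∈ V) (hv : Tendsto v (𝓝[≠] 0) (𝓝 v₀)) (hwv : ∀ t ≠ 0, w t = w₀ + t • e (v t))
    (l : List E₀) (h1 : 1 ≤ l.length) (hn : l.length + 1 ≤ n) :
    Tendsto (fun t : ℝ => t⁻¹ • (dirDeriv f (l.map e) (w t) - dirDeriv f (l.map e) w₀)) (𝓝[≠] 0)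
      (𝓝 (dirDeriv f ((l ++ [v₀]).map e) w₀)) := by
  -- Appending the velocity to the nonempty `l` gives order at least 2, the range of the uniform
  -- bound.
  have hc : Tendsto (fun p : E × E₀ => lineDeriv ℝ (dirDeriv f (l.map e)) p.1 (e p.2))
      (𝓝 w₀ ×ˢ 𝓝 v₀) (𝓝 (lineDeriv ℝ (dirDeriv f (l.map e)) w₀ (e v₀))) := by
    simp only [ListGateaux.lineDeriv_eq]
    exact h.tendsto_dirDeriv hV hB hw₀ tendsto_fst [(Prod.snd, v₀)]
      (by simpa using tendsto_snd) l (by simp; omega) (by simpa using hn)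
  have := tendsto_difference_quotient hV hw₀ (fun w hw a => h.lineDifferentiableAt l hn a hw) hc
    (w := fun _ => w₀) tendsto_const_nhds hv
  rw [ListGateaux.lineDeriv_eq] at this
  refine (tendsto_congr' ?_).1 this
  filter_upwards [self_mem_nhdsWithin] with t ht
  rw [hwv t ht]

theorem tendsto_of_quotient_tendsto {w : ℝ → E} {w₀ : E} {v : ℝ → E₀} {v₀ : E₀}
    (hv : Tendsto v (𝓝[≠] 0) (𝓝 v₀)) (hwv : ∀ t ≠ 0, w t = w₀ + t • e (v t)) :
    Tendsto w (𝓝[≠] 0) (𝓝 w₀) := by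
  have ht : Tendsto (fun t : ℝ => t) (𝓝[≠] 0) (𝓝 0) := nhdsWithin_le_nhds
  have := (ht.smul ((e.continuous.tendsto v₀).comp hv)).const_add w₀
  rw [zero_smul, add_zero] at this
  refine (tendsto_congr' ?_).1 this
  filter_upwards [self_mem_nhdsWithin] with t ht
  rw [hwv t ht]; rfl

/-- Derivative of an iterated directional derivative along a curve, with moving increments. -/
theorem ListGateaux.tendsto_quotient (h : ListGateaux n V e f) (hV : IsOpen V)
    (hB : UniformlyBoundedDerivs n c V e f) {w : ℝ → E} {w₀ : E} {v : ℝ → E₀} {v₀ : E₀}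
    (hw₀ : w₀ ∈ V) (hv : Tendsto v (𝓝[≠] 0) (𝓝 v₀)) (hwv : ∀ t ≠ 0, w t = w₀ + t • e (v t))
    {u x : X} (zs : List (X → E₀)) (hzs : ∀ z ∈ zs, LineDifferentiableAt ℝ z u x)
    (pre : List E₀) (h1 : 2 ≤ pre.length + zs.length) (hn : pre.length + zs.length + 1 ≤ n) :
    Tendsto (fun t : ℝ => t⁻¹ • (dirDeriv f ((pre ++ zs.map fun z => z (u + t • x)).map e) (w t)
        - dirDeriv f ((pre ++ zs.map fun z => z u).map e) w₀)) (𝓝[≠] 0)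
      (𝓝 (dirDeriv f ((pre ++ zs.map (fun z => z u) ++ [v₀]).map e) w₀ +
        ((slotDerivs x zs).map fun l => dirDeriv f ((pre ++ l.map fun z => z u).map e) w₀).sum)) := by
  have hwt := tendsto_of_quotient_tendsto hv hwv
  induction zs generalizing pre with
  | nil =>
    simp only [List.map_nil, List.append_nil, slotDerivs, List.sum_nil, add_zero]
    exact h.tendsto_quotient_const hV hB hw₀ hv hwv pre (by simp at h1; omega) (by simpa using hn)
  | cons z zs ih =>
    simp only [List.length_cons] at h1 hn
    have hz := (hzs z (by simp)).hasLineDerivAt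
    rw [hasLineDerivAt_iff_tendsto] at hz
    have hcont : ∀ z ∈ zs, Tendsto (fun t : ℝ => z (u + t • x)) (𝓝[≠] 0) (𝓝 (z u)) :=
      fun z hz => (hzs z (by simp [hz])).tendsto.mono_left nhdsWithin_le_nhds
    -- Product rule, one slot at a time: `a1` varies the remaining slots and the base point with
    -- this slot frozen at `z u`; `a2` puts the difference quotient of `z` into this slot.
    have a1 := ih (fun z hz => hzs z (by simp [hz])) (pre ++ [z u]) (by simp; omega)
      (by simp; omega)
    have a2 := h.tendsto_dirDeriv hV hB hw₀ hwt
      ((fun t : ℝ => t⁻¹ • (z (u + t • x) - z u), lineDeriv ℝ z u x) ::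
        zs.map fun z => (fun t : ℝ => z (u + t • x), z u))
      (by
        intro p hp
        rcases List.mem_cons.1 hp with rfl | hp
        · exact hz
        · obtain ⟨z', hz', rfl⟩ := List.mem_map.1 hp
          exact hcont z' hz') pre (by simp; omega) (by simp; omega)
    have a3 := a2.add a1
    simp only [List.map_cons, List.map_map, Function.comp_def, List.append_assoc,
      List.nil_append, List.cons_append] at a3
    simp only [slotDerivs, List.map_cons, List.map_map, Function.comp_def, List.append_assoc,
      List.sum_cons, List.cons_append]
    rw [add_left_comm]
    refine (tendsto_congr' ?_).1 a3
    filter_upwards [hwt (hV.mem_nhds hw₀)] with t ht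
    have e1 := h.smul_mid hV pre (zs.map fun z => z (u + t • x)) t⁻¹ (z (u + t • x) - z u)
      (by simp; omega) ht
    have e2 := h.sub_mid hV pre (zs.map fun z => z (u + t • x)) (z (u + t • x)) (z u)
      (by simp; omega) ht
    simp only [List.map_append, List.map_cons, List.map_map, Function.comp_def] at e1 e2 ⊢
    rw [e1, e2, ← smul_add]
    congr 1; abel

end ChainRule

/-! ### Uniform bounds for increments in the product. -/

section Step

variable {X : Type*} [NormedAddCommGroup X] [NormedSpace ℝ X]
variable {Y : Type*} [NormedAddCommGroup Y] [NormedSpace ℝ Y]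
variable {Z : Type*} [NormedAddCommGroup Z] [NormedSpace ℝ Z]

/-- The embedding of the increments `X × Z → X × Y`. -/
noncomputable abbrev incr (X : Type*) [NormedAddCommGroup X] [NormedSpace ℝ X] {Y Z : Type*}
    [NormedAddCommGroup Y] [NormedSpace ℝ Y] [NormedAddCommGroup Z] [NormedSpace ℝ Z]
    (ι : Z →L[ℝ] Y) : X × Z →L[ℝ] X × Y :=
  (ContinuousLinearMap.id ℝ X).prodMap ι

/-- Splitting every increment as `(x, 0) + (0, z)` expands the form into at most `2 ^ n` terms, and
symmetry sorts each one into the order of the hypotheses. -/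
theorem uniformlyBoundedDerivs_of_mixed {n : ℕ} {M : ℝ} (hM : 0 ≤ M) {U : Set X} (hU : IsOpen U)
    {ι : Z →L[ℝ] Y} {h : X × Y → Y}
    (hG : ListGateaux n (U ×ˢ univ) (incr X ι) h)
    (hl : ∀ xs : List X, 1 ≤ xs.length → xs.length ≤ n → ∀ w ∈ U, ∀ y : Y,
      ‖dirDeriv h (xs.map fun x => (x, (0 : Y))) (w, y)‖ ≤ M * (xs.map norm).prod)
    (hm : ∀ (xs : List X) (zs : List Z), 1 ≤ zs.length → 2 ≤ xs.length + zs.length →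
      xs.length + zs.length ≤ n → ∀ w ∈ U, ∀ y : Y,
      ‖dirDeriv h ((xs.map fun x => (x, (0 : Y))) ++ zs.map fun z => ((0 : X), ι z)) (w, y)‖
        ≤ M * (xs.map norm).prod * (zs.map norm).prod) :
    UniformlyBoundedDerivs n (2 ^ n * M) (U ×ˢ univ) (incr X ι) h := by
  have hV : IsOpen (U ×ˢ (univ : Set Y)) := hU.prod isOpen_univ
  -- `xs` and `zs` collect the components already split off and sorted, while `l` is what remains to
  -- be split.
  have main : ∀ (l : List (X × Z)) (xs : List X) (zs : List Z),
      2 ≤ xs.length + zs.length + l.length → xs.length + zs.length + l.length ≤ n →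
      ∀ w ∈ U ×ˢ (univ : Set Y),
      ‖dirDeriv h (((xs.map fun x => (x, (0 : Z))) ++ (zs.map fun z => ((0 : X), z)) ++ l).map
        (incr X ι)) w‖
        ≤ 2 ^ l.length * (M * (xs.map norm).prod * (zs.map norm).prod * (l.map norm).prod) := by
    intro l
    induction l with
    | nil =>
      rintro xs zs h2 hn ⟨w, y⟩ ⟨hw, -⟩
      simp only [List.length_nil, add_zero] at h2 hn
      rcases Nat.eq_zero_or_pos zs.length with h0 | h0
      · rw [List.length_eq_zero_iff] at h0
        subst h0
        simp only [List.length_nil, add_zero] at h2 hn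
        simpa [Function.comp_def] using hl xs (by omega) hn w hw y
      · simpa [Function.comp_def] using hm xs zs h0 h2 hn w hw y
    | cons p l ih =>
      intro xs zs h2 hn w hw
      simp only [List.length_cons] at h2 hn
      have hp : p = (p.1, (0 : Z)) + ((0 : X), p.2) := by simp
      have b1 := ih (xs ++ [p.1]) zs (by simp; omega) (by simp; omega) w hw
      have b2 := ih xs (zs ++ [p.2]) (by simp; omega) (by simp; omega) w hw
      have e1 := hG.perm hV (l₁ := (xs.map fun x => (x, (0 : Z))) ++ (zs.map fun z => ((0 : X), z))
          ++ (p.1, (0 : Z)) :: l)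
        (l₂ := ((xs ++ [p.1]).map fun x => (x, (0 : Z))) ++ (zs.map fun z => ((0 : X), z)) ++ l)
        (by
          simp only [List.map_append, List.append_assoc, List.map_cons, List.map_nil,
            List.singleton_append]
          exact List.Perm.append_left _ List.perm_middle) (by simp; omega) hw
      rw [hp, hG.add_mid hV _ _ _ _ (by simp; omega) hw, e1]
      have e2 : (xs.map fun x => (x, (0 : Z))) ++ (zs.map fun z => ((0 : X), z)) ++
          ((0 : X), p.2) :: l = (xs.map fun x => (x, (0 : Z))) ++
            ((zs ++ [p.2]).map fun z => ((0 : X), z)) ++ l := by simp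
      rw [e2, ← hp]
      refine (norm_add_le _ _).trans ((add_le_add b1 b2).trans ?_)
      simp only [List.map_append, List.map_cons, List.map_nil, List.prod_append, List.prod_cons,
        List.prod_nil, mul_one, List.length_cons]
      have hc1 : 0 ≤ M * (xs.map norm).prod * (zs.map norm).prod * (l.map norm).prod :=
        mul_nonneg (mul_nonneg (mul_nonneg hM (prod_norm_nonneg _)) (prod_norm_nonneg _)) (prod_norm_nonneg _)
      have hc : 0 ≤ 2 ^ l.length * (M * (xs.map norm).prod * (zs.map norm).prod *
        (l.map norm).prod) := mul_nonneg (by positivity) hc1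
      have n1 : ‖p.1‖ ≤ ‖p‖ := norm_fst_le p
      have n2 : ‖p.2‖ ≤ ‖p‖ := norm_snd_le p
      calc _ = (2 ^ l.length * (M * (xs.map norm).prod * (zs.map norm).prod *
            (l.map norm).prod)) * (‖p.1‖ + ‖p.2‖) := by ring
        _ ≤ (2 ^ l.length * (M * (xs.map norm).prod * (zs.map norm).prod *
            (l.map norm).prod)) * (‖p‖ + ‖p‖) := by gcongr
        _ = _ := by ring
  intro l h2 hn w hw
  have := main l [] [] (by simpa using h2) (by simpa using hn) w hw
  simp only [List.map_nil, List.nil_append, List.prod_nil, mul_one] at this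
  refine this.trans ?_
  rw [← mul_assoc]
  refine mul_le_mul_of_nonneg_right (mul_le_mul_of_nonneg_right ?_ hM) (prod_norm_nonneg _)
  exact pow_le_pow_right₀ (by norm_num) hn

end Step

/-! ### Calculus of functions with bounded iterated derivatives. -/

section BoundedDerivatives

variable {X : Type*} [NormedAddCommGroup X] [NormedSpace ℝ X]
variable {F : Type*} [NormedAddCommGroup F] [NormedSpace ℝ F]
variable {G : Type*} [NormedAddCommGroup G] [NormedSpace ℝ G]

/-- The iterated directional derivatives of `f` of orders `0, …, r` along increments in the unit
ball exist and are bounded by `K` on `U`. -/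
def BddDeriv (U : Set X) (K : ℝ) : ℕ → (X → F) → Prop
  | 0, f => ∀ u ∈ U, ‖f u‖ ≤ K
  | r + 1, f => (∀ u ∈ U, ‖f u‖ ≤ K) ∧ ∀ x, ‖x‖ ≤ 1 →
      (∀ u ∈ U, LineDifferentiableAt ℝ f u x) ∧ BddDeriv U K r (fun u => lineDeriv ℝ f u x)

/-- The iterated directional derivatives of `f` of orders `1, …, r + 1` along increments in the
unit ball exist and are bounded by `K` on `U`. -/
def DerivBdd (U : Set X) (K : ℝ) (r : ℕ) (f : X → F) : Prop :=
  ∀ x, ‖x‖ ≤ 1 →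
    (∀ u ∈ U, LineDifferentiableAt ℝ f u x) ∧ BddDeriv U K r (fun u => lineDeriv ℝ f u x)

variable {U : Set X} {K K' : ℝ} {r : ℕ} {f g : X → F}

namespace BddDeriv

theorem bound (h : BddDeriv U K r f) : ∀ u ∈ U, ‖f u‖ ≤ K := by
  cases r with
  | zero => exact h
  | succ r => exact h.1

theorem mono (h : BddDeriv U K r f) (hK : K ≤ K') : BddDeriv U K' r f := by
  induction r generalizing f with
  | zero => exact fun u hu => (h u hu).trans hK
  | succ r ih => exact ⟨fun u hu => (h.1 u hu).trans hK, fun x hx => ⟨(h.2 x hx).1, ih (h.2 x hx).2⟩⟩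

theorem of_succ (h : BddDeriv U K (r + 1) f) : BddDeriv U K r f := by
  induction r generalizing f with
  | zero => exact h.1
  | succ r ih => exact ⟨h.1, fun x hx => ⟨(h.2 x hx).1, ih (h.2 x hx).2⟩⟩

theorem of_le {s : ℕ} (h : BddDeriv U K r f) (hs : s ≤ r) : BddDeriv U K s f := by
  induction r with
  | zero => rwa [Nat.le_zero.1 hs]
  | succ r ih =>
    rcases Nat.lt_or_ge s (r + 1) with h1 | h1
    · exact ih h.of_succ (by omega)
    · rwa [Nat.le_antisymm hs h1]

theorem congr (hU : IsOpen U) (h : BddDeriv U K r f) (hfg : EqOn f g U) : BddDeriv U K r g := by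
  induction r generalizing f g with
  | zero => exact fun u hu => hfg hu ▸ h u hu
  | succ r ih =>
    exact ⟨fun u hu => hfg hu ▸ h.1 u hu, fun x hx =>
      ⟨fun u hu => lineDifferentiableAt_congr_of_eqOn hU hfg hu ((h.2 x hx).1 u hu),
        ih (h.2 x hx).2 fun u hu => lineDeriv_congr_of_eqOn hU hfg hu x⟩⟩

theorem zero (hU : IsOpen U) : BddDeriv U 0 r (fun _ : X => (0 : F)) := by
  induction r with
  | zero => intro u _; simp
  | succ r ih =>
    have hd : ∀ u x : X, HasLineDerivAt ℝ (fun _ : X => (0 : F)) 0 u x :=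
      fun u x => hasDerivAt_const _ _
    exact ⟨fun u _ => by simp, fun x _ => ⟨fun u _ => (hd u x).lineDifferentiableAt,
      ih.congr hU fun u _ => (hd u x).lineDeriv.symm⟩⟩

theorem add (hU : IsOpen U) (hf : BddDeriv U K r f) (hg : BddDeriv U K' r g) :
    BddDeriv U (K + K') r (fun u => f u + g u) := by
  induction r generalizing f g with
  | zero => exact fun u hu => norm_add_le_of_le (hf u hu) (hg u hu)
  | succ r ih =>
    have hd : ∀ u ∈ U, ∀ x : X, ‖x‖ ≤ 1 → HasLineDerivAt ℝ (fun u => f u + g u)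
        (lineDeriv ℝ f u x + lineDeriv ℝ g u x) u x := fun u hu x hx =>
      HasDerivAt.add ((hf.2 x hx).1 u hu).hasLineDerivAt ((hg.2 x hx).1 u hu).hasLineDerivAt
    exact ⟨fun u hu => norm_add_le_of_le (hf.1 u hu) (hg.1 u hu), fun x hx =>
      ⟨fun u hu => (hd u hu x hx).lineDifferentiableAt,
        (ih (hf.2 x hx).2 (hg.2 x hx).2).congr hU fun u hu => (hd u hu x hx).lineDeriv.symm⟩⟩

theorem list_sum (hU : IsOpen U) {A : Type*} (L : List A) (φ : A → X → F)
    (h : ∀ a ∈ L, BddDeriv U K r (φ a)) :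
    BddDeriv U (L.length * K) r (fun u => (L.map fun a => φ a u).sum) := by
  induction L with
  | nil => simpa using zero hU
  | cons a L ih =>
    have h1 := (h a (by simp)).add hU (ih fun b hb => h b (by simp [hb]))
    simp only [List.map_cons, List.sum_cons, List.length_cons]
    refine h1.mono (le_of_eq ?_)
    push_cast; ring

theorem const_prodMk (hU : IsOpen U) (h : BddDeriv U K r f) {a : G} (ha : ‖a‖ ≤ K) :
    BddDeriv U K r (fun u => (a, f u)) := by
  induction r generalizing f a with
  | zero => exact fun u hu => max_le ha (h u hu)
  | succ r ih =>
    have hd : ∀ u ∈ U, ∀ x : X, ‖x‖ ≤ 1 → HasLineDerivAt ℝ (fun u => (a, f u))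
        ((0 : G), lineDeriv ℝ f u x) u x := fun u hu x hx =>
      HasDerivAt.prodMk (hasDerivAt_const _ _) ((h.2 x hx).1 u hu).hasLineDerivAt
    refine ⟨fun u hu => max_le ha (h.1 u hu), fun x hx =>
      ⟨fun u hu => (hd u hu x hx).lineDifferentiableAt,
        (ih (h.2 x hx).2 ?_).congr hU fun u hu => (hd u hu x hx).lineDeriv.symm⟩⟩
    rw [norm_zero]; exact (norm_nonneg a).trans ha

theorem const_smul (hU : IsOpen U) (h : BddDeriv U K r f) (c : ℝ) :
    BddDeriv U (|c| * K) r (fun u => c • f u) := by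
  have hb : ∀ {f : X → F}, (∀ u ∈ U, ‖f u‖ ≤ K) → ∀ u ∈ U, ‖c • f u‖ ≤ |c| * K :=
    fun h u hu => by
      rw [norm_smul, Real.norm_eq_abs]
      exact mul_le_mul_of_nonneg_left (h u hu) (abs_nonneg c)
  induction r generalizing f with
  | zero => exact hb h
  | succ r ih =>
    have hd : ∀ u ∈ U, ∀ x : X, ‖x‖ ≤ 1 → HasLineDerivAt ℝ (fun u => c • f u)
        (c • lineDeriv ℝ f u x) u x := fun u hu x hx =>
      HasDerivAt.const_smul c ((h.2 x hx).1 u hu).hasLineDerivAt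
    exact ⟨hb h.1, fun x hx => ⟨fun u hu => (hd u hu x hx).lineDifferentiableAt,
      (ih (h.2 x hx).2).congr hU fun u hu => (hd u hu x hx).lineDeriv.symm⟩⟩

end BddDeriv

theorem DerivBdd.mono (h : DerivBdd U K r f) (hK : K ≤ K') : DerivBdd U K' r f :=
  fun x hx => ⟨(h x hx).1, (h x hx).2.mono hK⟩

/-- Rescaling by `‖x‖ + 1`, which is never zero, moves `x` into the unit ball. The constant is lost,
but existence of derivatives does not need it. -/
theorem DerivBdd.exists_bddDeriv (hU : IsOpen U) (h : DerivBdd U K r f) (x : X) :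
    (∀ u ∈ U, LineDifferentiableAt ℝ f u x) ∧
      ∃ K', BddDeriv U K' r (fun u => lineDeriv ℝ f u x) := by
  have hx : x = (‖x‖ + 1) • ((‖x‖ + 1)⁻¹ • x) := by
    rw [smul_inv_smul₀ (by positivity)]
  have hn : ‖(‖x‖ + 1)⁻¹ • x‖ ≤ 1 := by
    rw [norm_smul, norm_inv, Real.norm_of_nonneg (by positivity), inv_mul_le_iff₀ (by positivity)]
    linarith
  obtain ⟨h1, h2⟩ := h _ hn
  rw [hx]
  refine ⟨fun u hu => (h1 u hu).smul _, _, (h2.const_smul hU (‖x‖ + 1)).congr hU fun u _ => ?_⟩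
  exact lineDeriv_smul.symm

theorem BddDeriv.dirDiffOn (hU : IsOpen U) {l : List X} (h : BddDeriv U K l.length f) :
    DirDiffOn U f l := by
  induction l generalizing K f with
  | nil => trivial
  | cons x l ih =>
    have h' : DerivBdd U K l.length f := h.2
    obtain ⟨h1, K', h2⟩ := h'.exists_bddDeriv hU x
    exact ⟨h1, ih h2⟩

theorem BddDeriv.norm_dirDeriv_le {l : List X} (h : BddDeriv U K l.length f)
    (hl : ∀ x ∈ l, ‖x‖ ≤ 1) {u : X} (hu : u ∈ U) : ‖dirDeriv f l u‖ ≤ K := by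
  induction l generalizing f with
  | nil => exact h u hu
  | cons x l ih => exact ih (h.2 x (hl x (by simp))).2 fun y hy => hl y (by simp [hy])

theorem DerivBdd.dirDiffOn (hU : IsOpen U) {l : List X} (hl : l.length = r + 1)
    (h : DerivBdd U K r f) : DirDiffOn U f l := by
  match l, hl with
  | x :: l, hl =>
    obtain ⟨h1, K', h2⟩ := h.exists_bddDeriv hU x
    rw [← Nat.succ_inj.1 hl] at h2
    exact ⟨h1, h2.dirDiffOn hU⟩

theorem DerivBdd.norm_dirDeriv_le {l : List X} (hl : l.length = r + 1) (h : DerivBdd U K r f)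
    (hl1 : ∀ x ∈ l, ‖x‖ ≤ 1) {u : X} (hu : u ∈ U) : ‖dirDeriv f l u‖ ≤ K := by
  match l, hl with
  | x :: l, hl =>
    have h2 := (h x (hl1 x (by simp))).2
    rw [← Nat.succ_inj.1 hl] at h2
    exact h2.norm_dirDeriv_le (fun y hy => hl1 y (by simp [hy])) hu

theorem slotDerivs_length (x : X) (zs : List (X → F)) : (slotDerivs x zs).length = zs.length := by
  induction zs with
  | nil => rfl
  | cons z zs ih => simp [slotDerivs, ih]

/-- Intended for `P` and `Q` expressing bounded derivatives up to orders `r + 1` and `r`: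
differentiating one slot loses one order. -/
theorem slotDerivs_spec {P Q : (X → F) → Prop} {x : X} {zs : List (X → F)} (hP : ∀ z ∈ zs, P z)
    (hPQ : ∀ z, P z → Q z) (hd : ∀ z, P z → Q fun u => lineDeriv ℝ z u x) :
    ∀ l ∈ slotDerivs x zs, l.length = zs.length ∧ ∀ z ∈ l, Q z := by
  induction zs with
  | nil => simp [slotDerivs]
  | cons z zs ih =>
    have ih' := ih fun y hy => hP y (by simp [hy])
    intro l hl
    rcases List.mem_cons.1 hl with rfl | hl
    · refine ⟨by simp, fun y hy => ?_⟩
      rcases List.mem_cons.1 hy with rfl | hy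
      · exact hd _ (hP z (by simp))
      · exact hPQ _ (hP y (by simp [hy]))
    · obtain ⟨l', hl', rfl⟩ := List.mem_map.1 hl
      refine ⟨by simp [(ih' l' hl').1], fun y hy => ?_⟩
      rcases List.mem_cons.1 hy with rfl | hy
      · exact hPQ _ (hP y (by simp))
      · exact (ih' l' hl').2 y hy

end BoundedDerivatives

/-! ### Contraction estimates. -/

section Contraction

variable {Y : Type*} [NormedAddCommGroup Y]

/-- The term `α * ‖a t - Δ‖` is absorbed on the left, so no prior boundedness of the difference
quotients is required. -/
theorem tendsto_of_norm_sub_le {τ : Type*} {L : Filter τ} {a : τ → Y} {b : τ → ℝ} {Δ : Y} {α : ℝ}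
    (hα : α < 1) (hb : Tendsto b L (𝓝 0)) (h : ∀ᶠ t in L, ‖a t - Δ‖ ≤ α * ‖a t - Δ‖ + b t) :
    Tendsto a L (𝓝 Δ) := by
  rw [tendsto_iff_norm_sub_tendsto_zero]
  have hb' : Tendsto (fun t => (1 - α)⁻¹ * b t) L (𝓝 0) := by simpa using hb.const_mul (1 - α)⁻¹
  refine squeeze_zero' (Eventually.of_forall fun t => norm_nonneg _) ?_ hb'
  filter_upwards [h] with t ht
  rw [le_inv_mul_iff₀ (by linarith)]
  linarith

theorem exists_eq_add_of_contraction [CompleteSpace Y] {α : ℝ} (hα₀ : 0 ≤ α) (hα₁ : α < 1)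
    {L : Y → Y} (hL : ∀ z z', ‖L z - L z'‖ ≤ α * ‖z - z'‖) : ∃ y, y = L y := by
  have hc : ContractingWith ⟨α, hα₀⟩ L := by
    refine ⟨by exact_mod_cast hα₁, LipschitzWith.of_dist_le_mul fun z z' => ?_⟩
    rw [dist_eq_norm, dist_eq_norm]; exact hL z z'
  exact ⟨ContractingWith.fixedPoint L hc, (ContractingWith.fixedPoint_isFixedPt hc).symm⟩

theorem eq_of_fixed_of_contraction {α : ℝ} (hα₁ : α < 1) {L : Y → Y}
    (hL : ∀ z z', ‖L z - L z'‖ ≤ α * ‖z - z'‖) {y y' : Y} (hy : L y = y) (hy' : L y' = y') :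
    y = y' := by
  have h := hL y y'
  rw [hy, hy'] at h
  have : ‖y - y'‖ = 0 := by nlinarith [norm_nonneg (y - y')]
  exact sub_eq_zero.1 (norm_eq_zero.1 this)

theorem norm_le_of_eq_add_of_contraction {α : ℝ} (hα₁ : α < 1) {L : Y → Y}
    (hL : ∀ z, ‖L z‖ ≤ α * ‖z‖) {y a : Y} {K : ℝ} (hy : y = a + L y) (ha : ‖a‖ ≤ K) :
    ‖y‖ ≤ (1 - α)⁻¹ * K := by
  have h1 : ‖y‖ ≤ ‖a‖ + ‖L y‖ := by
    conv_lhs => rw [hy]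
    exact norm_add_le _ _
  have h2 := hL y
  rw [le_inv_mul_iff₀ (by linarith)]
  linarith

end Contraction

/-! ### First derivative of the fixed point. -/

section ParametricContraction

variable {X : Type*} [NormedAddCommGroup X] [NormedSpace ℝ X]
variable {Y : Type*} [NormedAddCommGroup Y] [NormedSpace ℝ Y]

/-- The two difference quotients share the value `h w`, so the contraction estimate passes to the
limit without linearity of `z ↦ ∂_z h`. -/
theorem norm_lineDeriv_sub_le_of_contraction {α : ℝ} {U : Set X} {h : X × Y → Y}
    (hc : ∀ w ∈ U, ∀ y y' : Y, ‖h (w, y) - h (w, y')‖ ≤ α * ‖y - y'‖)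
    (hd : ∀ w ∈ U ×ˢ (univ : Set Y), ∀ z : Y, LineDifferentiableAt ℝ h w (0, z))
    {w : X × Y} (hw : w ∈ U ×ˢ (univ : Set Y)) (z z' : Y) :
    ‖lineDeriv ℝ h w (0, z) - lineDeriv ℝ h w (0, z')‖ ≤ α * ‖z - z'‖ := by
  have h1 := hasLineDerivAt_iff_tendsto.1 (hd w hw z).hasLineDerivAt
  have h2 := hasLineDerivAt_iff_tendsto.1 (hd w hw z').hasLineDerivAt
  refine le_of_tendsto (h1.sub h2).norm ?_
  filter_upwards [self_mem_nhdsWithin] with t ht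
  have ht' : t ≠ 0 := ht
  rw [← smul_sub, sub_sub_sub_cancel_right, norm_smul, norm_inv, Real.norm_eq_abs,
    inv_mul_le_iff₀ (abs_pos.2 ht')]
  have := hc w.1 hw.1 (w.2 + t • z) (w.2 + t • z')
  rw [add_sub_add_left_eq_sub, ← smul_sub, norm_smul, Real.norm_eq_abs] at this
  have e : ∀ z : Y, w + t • ((0 : X), z) = (w.1, w.2 + t • z) := fun z => by ext <;> simp
  rw [e, e]
  linarith

theorem norm_lineDeriv_le_of_contraction {α : ℝ} {U : Set X} {h : X × Y → Y}
    (hc : ∀ w ∈ U, ∀ y y' : Y, ‖h (w, y) - h (w, y')‖ ≤ α * ‖y - y'‖)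
    (hd : ∀ w ∈ U ×ˢ (univ : Set Y), ∀ z : Y, LineDifferentiableAt ℝ h w (0, z))
    {w : X × Y} (hw : w ∈ U ×ˢ (univ : Set Y)) (z : Y) :
    ‖lineDeriv ℝ h w (0, z)‖ ≤ α * ‖z‖ := by
  have := norm_lineDeriv_sub_le_of_contraction hc hd hw z 0
  rwa [Prod.mk_zero_zero, lineDeriv_zero, sub_zero, sub_zero] at this

/-- Directional differentiability of the fixed point of a parametric contraction. -/
theorem exists_hasLineDerivAt_fixedPoint [CompleteSpace Y] {α : ℝ} (hα₀ : 0 ≤ α) (hα₁ : α < 1)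
    {U : Set X} (hU : IsOpen U) {h : X × Y → Y}
    (hc : ∀ w ∈ U, ∀ y y' : Y, ‖h (w, y) - h (w, y')‖ ≤ α * ‖y - y'‖)
    (hd : ∀ w ∈ U ×ˢ (univ : Set Y), ∀ z : Y, LineDifferentiableAt ℝ h w (0, z))
    (hcont : ContinuousOn (fun p : (X × Y) × Y => lineDeriv ℝ h p.1 (0, p.2))
      ((U ×ˢ univ) ×ˢ univ))
    {φ : X → Y} (hφ : ∀ u ∈ U, h (u, φ u) = φ u) {u : X} (hu : u ∈ U) {x : X}
    (hx : LineDifferentiableAt ℝ h (u, φ u) (x, 0)) :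
    ∃ Δ, HasLineDerivAt ℝ φ Δ u x ∧
      Δ = lineDeriv ℝ h (u, φ u) (x, 0) + lineDeriv ℝ h (u, φ u) (0, Δ) := by
  have hV : IsOpen (U ×ˢ (univ : Set Y)) := hU.prod isOpen_univ
  have hw₀ : (u, φ u) ∈ U ×ˢ (univ : Set Y) := ⟨hu, trivial⟩
  obtain ⟨Δ, hΔ⟩ := exists_eq_add_of_contraction hα₀ hα₁
    (L := fun z => lineDeriv ℝ h (u, φ u) (x, 0) + lineDeriv ℝ h (u, φ u) (0, z)) (fun z z' => by
      rw [add_sub_add_left_eq_sub]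
      exact norm_lineDeriv_sub_le_of_contraction hc hd hw₀ z z')
  refine ⟨Δ, ?_, hΔ⟩
  have hline : Tendsto (fun t : ℝ => (u, φ u) + t • (x, (0 : Y))) (𝓝[≠] 0) (𝓝 (u, φ u)) :=
    (tendsto_add_smul_nhds_zero _ _).mono_left nhdsWithin_le_nhds
  have q1 := hasLineDerivAt_iff_tendsto.1 hx.hasLineDerivAt
  -- The base points `(u + t • x, φ u)` lie off the graph of `φ`, so no continuity of `φ` is needed.
  have q2 := tendsto_difference_quotient (e := ContinuousLinearMap.inr ℝ X Y) (v₀ := Δ) hV hw₀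
    (fun w hw v => hd w hw v) (by
      have := (hcont.continuousAt ((hV.prod isOpen_univ).mem_nhds
        (⟨hw₀, trivial⟩ : ((u, φ u), Δ) ∈ (U ×ˢ (univ : Set Y)) ×ˢ (univ : Set Y)))).tendsto
      rwa [nhds_prod_eq] at this) hline (v := fun _ => Δ) tendsto_const_nhds
  have q3 := (q1.add q2).sub_const Δ |>.norm
  simp only [ContinuousLinearMap.inr_apply] at q3
  rw [← hΔ, sub_self, norm_zero] at q3
  rw [hasLineDerivAt_iff_tendsto]
  refine tendsto_of_norm_sub_le hα₁ q3 ?_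
  have hmem : ∀ᶠ t : ℝ in 𝓝[≠] 0, u + t • x ∈ U :=
    ((tendsto_add_smul_nhds_zero u x).mono_left nhdsWithin_le_nhds).eventually (hU.mem_nhds hu)
  filter_upwards [hmem, self_mem_nhdsWithin] with t htU ht
  have ht' : t ≠ 0 := ht
  have e1 : (u, φ u) + t • (x, (0 : Y)) = (u + t • x, φ u) := by ext <;> simp
  have e2 : (u + t • x, φ u) + t • ((0 : X), Δ) = (u + t • x, φ u + t • Δ) := by ext <;> simp
  rw [e1, e2, ← smul_add, hφ u hu]
  -- The true value `φ (u + t • x)` is compared with the linear prediction `φ u + t • Δ` inside `h`: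
  -- the first term contracts, the second tends to zero by the equation for `Δ`.
  have e3 : t⁻¹ • (φ (u + t • x) - φ u) - Δ =
      t⁻¹ • (h (u + t • x, φ (u + t • x)) - h (u + t • x, φ u + t • Δ)) +
      (t⁻¹ • (h (u + t • x, φ u) - φ u + (h (u + t • x, φ u + t • Δ) - h (u + t • x, φ u))) - Δ)
      := by
    rw [hφ _ htU, add_sub_assoc', ← smul_add]
    congr 2; abel
  have e4 : ‖t⁻¹ • (h (u + t • x, φ (u + t • x)) - h (u + t • x, φ u + t • Δ))‖ ≤
      α * ‖t⁻¹ • (φ (u + t • x) - φ u) - Δ‖ := by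
    have e5 : t⁻¹ • (φ (u + t • x) - φ u) - Δ = t⁻¹ • (φ (u + t • x) - (φ u + t • Δ)) := by
      rw [← sub_sub, smul_sub t⁻¹ (φ (u + t • x) - φ u), inv_smul_smul₀ ht']
    rw [e5, norm_smul, norm_smul, mul_left_comm]
    exact mul_le_mul_of_nonneg_left (hc _ htU _ _) (norm_nonneg _)
  exact (congrArg norm e3).trans_le (norm_add_le_of_le e4 le_rfl)

end ParametricContraction

/-! ### Explicit constants. -/

/-- Bound for the derivatives of order at most `r` of a form of degree `p`, with values bounded by
`c` on unit vectors, evaluated at increments whose derivatives are bounded by `K`. -/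
noncomputable def formBound (c K : ℝ) : ℕ → ℕ → ℝ
  | 0, p => c * K ^ p
  | r + 1, p => c * K ^ p + (formBound c K r (p + 1) + p * formBound c K r p)

theorem formBound_nonneg {c K : ℝ} (hc : 0 ≤ c) (hK : 0 ≤ K) (r p : ℕ) : 0 ≤ formBound c K r p := by
  induction r generalizing p with
  | zero => exact mul_nonneg hc (pow_nonneg hK p)
  | succ r ih =>
    exact add_nonneg (mul_nonneg hc (pow_nonneg hK p))
      (add_nonneg (ih _) (mul_nonneg (Nat.cast_nonneg p) (ih _)))

/-- Bound for the derivatives of order at most `r` of the solution of a linear fixed-point equation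
whose inhomogeneous term has derivatives bounded by `A`. -/
noncomputable def solutionBound (α c K : ℝ) : ℕ → ℝ → ℝ
  | 0, A => (1 - α)⁻¹ * A
  | r + 1, A => (1 - α)⁻¹ * A + solutionBound α c K r (A + formBound c K r 2)

theorem solutionBound_nonneg {α c K A : ℝ} (hα : α < 1) (hc : 0 ≤ c) (hK : 0 ≤ K) (hA : 0 ≤ A)
    (r : ℕ) : 0 ≤ solutionBound α c K r A := by
  have h1 : 0 ≤ (1 - α)⁻¹ := inv_nonneg.2 (by linarith)
  induction r generalizing A with
  | zero => exact mul_nonneg h1 hA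
  | succ r ih =>
    exact add_nonneg (mul_nonneg h1 hA) (ih (add_nonneg hA (formBound_nonneg hc hK r 2)))

/-! ### Gaining one derivative while losing one space. -/

section Step

variable {X : Type*} [NormedAddCommGroup X] [NormedSpace ℝ X]
variable {Y : Type*} [NormedAddCommGroup Y] [NormedSpace ℝ Y]
variable {Z : Type*} [NormedAddCommGroup Z] [NormedSpace ℝ Z]

/-- A parametric contraction on `Y` which is strongly differentiable along `X × Z`, with uniform
bounds on its derivatives of orders `2, …, n`. -/
structure ContractionStep (n : ℕ) (α c : ℝ) (U : Set X) (ι : Z →L[ℝ] Y) (h : X × Y → Y) :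
    Prop where
  isOpen : IsOpen U
  gateaux : ListGateaux n (U ×ˢ univ) (incr X ι) h
  bounded : UniformlyBoundedDerivs n c (U ×ˢ univ) (incr X ι) h
  contraction : ∀ w ∈ U, ∀ y y' : Y, ‖h (w, y) - h (w, y')‖ ≤ α * ‖y - y'‖
  right_diff : ∀ w ∈ U ×ˢ (univ : Set Y), ∀ z : Y, LineDifferentiableAt ℝ h w (0, z)
  right_cont : ∀ z : Y, ContinuousOn (fun w => lineDeriv ℝ h w (0, z)) (U ×ˢ univ)

namespace ContractionStep

variable {n : ℕ} {α c : ℝ} {U : Set X} {ι : Z →L[ℝ] Y} {h : X × Y → Y} {Φ : X → Z}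

theorem isOpen_prod (S : ContractionStep n α c U ι h) : IsOpen (U ×ˢ (univ : Set Y)) :=
  S.isOpen.prod isOpen_univ

theorem tendsto_velocity {u x : X} (hΦ : LineDifferentiableAt ℝ Φ u x) :
    Tendsto (fun t : ℝ => (x, t⁻¹ • (Φ (u + t • x) - Φ u))) (𝓝[≠] 0)
      (𝓝 (x, lineDeriv ℝ Φ u x)) :=
  tendsto_const_nhds.prodMk_nhds (hasLineDerivAt_iff_tendsto.1 hΦ.hasLineDerivAt)

/-- The chords of the graph come from `X × Z`, so they are admissible increments for `h`. -/
theorem curve_eq (u x : X) (t : ℝ) (ht : t ≠ 0) :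
    (u + t • x, ι (Φ (u + t • x))) =
      (u, ι (Φ u)) + t • incr X ι (x, t⁻¹ • (Φ (u + t • x) - Φ u)) := by
  ext
  · simp
  · simp [smul_inv_smul₀ ht]

/-- The derivative of `h` along increments depending on `u`, taken at the point `(u, Φ u)`. -/
noncomputable def form (ι : Z →L[ℝ] Y) (h : X × Y → Y) (Φ : X → Z) (zs : List (X → X × Z))
    (u : X) : Y :=
  dirDeriv h ((zs.map fun z => z u).map (incr X ι)) (u, ι (Φ u))

theorem hasLineDerivAt_form (S : ContractionStep n α c U ι h) {u x : X} (hu : u ∈ U)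
    (hΦ : LineDifferentiableAt ℝ Φ u x) {zs : List (X → X × Z)} (h2 : 2 ≤ zs.length)
    (hn : zs.length + 1 ≤ n) (hzs : ∀ z ∈ zs, LineDifferentiableAt ℝ z u x) :
    HasLineDerivAt ℝ (form ι h Φ zs)
      (form ι h Φ (zs ++ [fun u => (x, lineDeriv ℝ Φ u x)]) u +
        ((slotDerivs x zs).map fun l => form ι h Φ l u).sum) u x := by
  rw [hasLineDerivAt_iff_tendsto]
  have := S.gateaux.tendsto_quotient S.isOpen_prod S.bounded
    (w := fun t : ℝ => (u + t • x, ι (Φ (u + t • x)))) (w₀ := (u, ι (Φ u))) ⟨hu, trivial⟩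
    (tendsto_velocity hΦ) (curve_eq u x) zs hzs [] (by simpa using h2) (by simpa using hn)
  simpa [form] using this

theorem hasLineDerivAt_dirDeriv_const (S : ContractionStep n α c U ι h) {u x : X} (hu : u ∈ U)
    (hΦ : LineDifferentiableAt ℝ Φ u x) (l : List (X × Z)) (h1 : 1 ≤ l.length)
    (hn : l.length + 1 ≤ n) :
    HasLineDerivAt ℝ (fun v => dirDeriv h (l.map (incr X ι)) (v, ι (Φ v)))
      (dirDeriv h ((l ++ [(x, lineDeriv ℝ Φ u x)]).map (incr X ι)) (u, ι (Φ u))) u x := by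
  rw [hasLineDerivAt_iff_tendsto]
  exact S.gateaux.tendsto_quotient_const S.isOpen_prod S.bounded
    (w := fun t : ℝ => (u + t • x, ι (Φ (u + t • x)))) (w₀ := (u, ι (Φ u))) ⟨hu, trivial⟩
    (tendsto_velocity hΦ) (curve_eq u x) l h1 hn

theorem prod_norm_le_pow {G : Type*} [SeminormedAddCommGroup G] {K : ℝ} (l : List G)
    (hl : ∀ a ∈ l, ‖a‖ ≤ K) : (l.map norm).prod ≤ K ^ l.length := by
  induction l with
  | nil => simp
  | cons a l ih =>
    have ha := hl a (by simp)
    simp only [List.map_cons, List.prod_cons, List.length_cons, pow_succ']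
    exact mul_le_mul ha (ih fun b hb => hl b (by simp [hb])) (prod_norm_nonneg l)
      ((norm_nonneg a).trans ha)

theorem norm_form_le (S : ContractionStep n α c U ι h) (hc : 0 ≤ c) {K : ℝ}
    {zs : List (X → X × Z)} (h2 : 2 ≤ zs.length) (hn : zs.length ≤ n) {u : X} (hu : u ∈ U)
    (hzs : ∀ z ∈ zs, ‖z u‖ ≤ K) : ‖form ι h Φ zs u‖ ≤ c * K ^ zs.length := by
  refine (S.bounded _ (by simpa using h2) (by simpa using hn) _ ⟨hu, trivial⟩).trans ?_
  refine mul_le_mul_of_nonneg_left ?_ hc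
  have := prod_norm_le_pow (K := K) (zs.map fun z => z u) (by simpa using hzs)
  simpa using this

/-- Bounds on the derivatives of the forms along the graph of `Φ`. -/
theorem bddDeriv_form (S : ContractionStep n α c U ι h) (hc : 0 ≤ c) {K : ℝ} (hK : 1 ≤ K) {s : ℕ}
    (hΦ : DerivBdd U K s Φ) (r : ℕ) (hr : r ≤ s + 1) (zs : List (X → X × Z)) (h2 : 2 ≤ zs.length)
    (hn : zs.length + r ≤ n) (hzs : ∀ z ∈ zs, BddDeriv U K r z) :
    BddDeriv U (formBound c K r zs.length) r (form ι h Φ zs) := by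
  have hK0 : 0 ≤ K := by linarith
  induction r generalizing zs with
  | zero => exact fun u hu => S.norm_form_le hc h2 hn hu fun z hz => hzs z hz u hu
  | succ r ih =>
    have hd : ∀ x : X, ‖x‖ ≤ 1 → ∀ u ∈ U, _ := fun x hx u hu =>
      S.hasLineDerivAt_form hu ((hΦ x hx).1 u hu) h2 (by omega)
        fun z hz => ((hzs z hz).2 x hx).1 u hu
    have hpos : 0 ≤ c * K ^ zs.length := by positivity
    have hf1 := formBound_nonneg hc hK0 r (zs.length + 1)
    have hf2 := mul_nonneg (Nat.cast_nonneg (α := ℝ) zs.length) (formBound_nonneg hc hK0 r zs.length)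
    refine ⟨fun u hu => (S.norm_form_le hc h2 (by omega) hu
      fun z hz => (hzs z hz).bound u hu).trans ?_, fun x hx =>
      ⟨fun u hu => (hd x hx u hu).lineDifferentiableAt, ?_⟩⟩
    · simp only [formBound]; linarith
    -- Moving the base point raises the degree by one and uses up one derivative, so degree plus
    -- order stays at most `n`.
    have b1 := ih (by omega) (zs ++ [fun u => (x, lineDeriv ℝ Φ u x)]) (by simp; omega)
      (by simp; omega) (by
        intro z hz
        rcases List.mem_append.1 hz with hz | hz
        · exact (hzs z hz).of_succ
        · rw [List.mem_singleton.1 hz]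
          exact ((hΦ x hx).2.of_le (by omega)).const_prodMk S.isOpen (hx.trans hK))
    have hslot := slotDerivs_spec (x := x) (P := fun z => BddDeriv U K (r + 1) z)
      (Q := fun z => BddDeriv U K r z) hzs (fun z hz => hz.of_succ) (fun z hz => (hz.2 x hx).2)
    have b2 := BddDeriv.list_sum S.isOpen (slotDerivs x zs) (form ι h Φ)
      (K := formBound c K r zs.length) fun l hl => by
        have := ih (by omega) l (by rw [(hslot l hl).1]; exact h2)
          (by rw [(hslot l hl).1]; omega) (hslot l hl).2
        rwa [(hslot l hl).1] at this
    refine ((b1.add S.isOpen b2).mono ?_).congr S.isOpen fun u hu => (hd x hx u hu).lineDeriv.symm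
    simp only [formBound, slotDerivs_length, List.length_append, List.length_singleton]
    linarith

theorem norm_lineDeriv_le (S : ContractionStep n α c U ι h) {w : X × Y} (hw : w ∈ U ×ˢ univ)
    (z : Y) : ‖lineDeriv ℝ h w (0, z)‖ ≤ α * ‖z‖ :=
  norm_lineDeriv_le_of_contraction S.contraction S.right_diff hw z

/-- Differentiation of the linear equation `g = A + ∂_g h`. -/
theorem exists_hasLineDerivAt_solution [CompleteSpace Y] (S : ContractionStep n α c U ι h)
    (hα₀ : 0 ≤ α) (hα₁ : α < 1) (hn : 2 ≤ n) {A g : X → Y} {γ : X → Z}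
    (hg : ∀ u ∈ U, g u = A u + lineDeriv ℝ h (u, ι (Φ u)) (0, g u))
    (hγ : ∀ u ∈ U, ι (γ u) = g u) {u x : X} (hu : u ∈ U)
    (hΦ : LineDifferentiableAt ℝ Φ u x) (hA : LineDifferentiableAt ℝ A u x) :
    ∃ Δ, HasLineDerivAt ℝ g Δ u x ∧
      Δ = (lineDeriv ℝ A u x +
        form ι h Φ [fun u => (0, γ u), fun u => (x, lineDeriv ℝ Φ u x)] u) +
          lineDeriv ℝ h (u, ι (Φ u)) (0, Δ) := by
  have hw₀ : (u, ι (Φ u)) ∈ U ×ˢ (univ : Set Y) := ⟨hu, trivial⟩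
  set σ := lineDeriv ℝ A u x + form ι h Φ [fun u => (0, γ u), fun u => (x, lineDeriv ℝ Φ u x)] u
    with hσ
  obtain ⟨Δ, hΔ⟩ := exists_eq_add_of_contraction hα₀ hα₁
    (L := fun z => σ + lineDeriv ℝ h (u, ι (Φ u)) (0, z)) (fun z z' => by
      rw [add_sub_add_left_eq_sub]
      exact norm_lineDeriv_sub_le_of_contraction S.contraction S.right_diff hw₀ z z')
  refine ⟨Δ, ?_, hΔ⟩
  have q1 := hasLineDerivAt_iff_tendsto.1 hA.hasLineDerivAt
  have q2 := hasLineDerivAt_iff_tendsto.1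
    (S.hasLineDerivAt_dirDeriv_const hu hΦ [(0, γ u)] (by simp) (by simpa using hn))
  have hcurve : Tendsto (fun t : ℝ => (u + t • x, ι (Φ (u + t • x)))) (𝓝[≠] 0) (𝓝 (u, ι (Φ u))) :=
    ((tendsto_add_smul_nhds_zero u x).prodMk_nhds
      ((ι.continuous.tendsto _).comp hΦ.tendsto)).mono_left nhdsWithin_le_nhds
  -- `Δ` is only known to lie in `Y`, so continuity of `∂_Δ h` along the curve must come from
  -- `right_cont`.
  have q3 := (((S.right_cont Δ).continuousAt (S.isOpen_prod.mem_nhds hw₀)).tendsto.comp hcurve)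
  have q4 := ((q1.add q2).add q3).sub_const Δ |>.norm
  have hform : dirDeriv h (([(0, γ u)] ++ [(x, lineDeriv ℝ Φ u x)]).map (incr X ι)) (u, ι (Φ u)) =
    form ι h Φ [fun u => (0, γ u), fun u => (x, lineDeriv ℝ Φ u x)] u := rfl
  rw [hform, ← hσ, ← hΔ, sub_self, norm_zero] at q4
  rw [hasLineDerivAt_iff_tendsto]
  refine tendsto_of_norm_sub_le hα₁ q4 ?_
  have hmem : ∀ᶠ t : ℝ in 𝓝[≠] 0, u + t • x ∈ U :=
    ((tendsto_add_smul_nhds_zero u x).mono_left nhdsWithin_le_nhds).eventually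
      (S.isOpen.mem_nhds hu)
  filter_upwards [hmem, self_mem_nhdsWithin] with t htU ht
  have hwt : (u + t • x, ι (Φ (u + t • x))) ∈ U ×ˢ (univ : Set Y) := ⟨htU, trivial⟩
  have hL : ∀ (w : X × Y) (z : Z), dirDeriv h ([((0 : X), z)].map (incr X ι)) w =
      lineDeriv ℝ h w (0, ι z) := fun w z => by simp [dirDeriv]
  simp only [hL, Function.comp, hγ u hu]
  set δ := t⁻¹ • (g (u + t • x) - g u) with hδ
  -- Linearity of the first derivative is available along `Z` only; it applies because `g` lifts to
  -- `γ`.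
  have e1 : lineDeriv ℝ h (u + t • x, ι (Φ (u + t • x))) (0, δ) =
      t⁻¹ • (lineDeriv ℝ h (u + t • x, ι (Φ (u + t • x))) (0, g (u + t • x)) -
        lineDeriv ℝ h (u + t • x, ι (Φ (u + t • x))) (0, g u)) := by
    have a1 := S.gateaux.smul_mid S.isOpen_prod [] [] t⁻¹ ((0 : X), γ (u + t • x) - γ u)
      (by simp; omega) hwt
    have a2 := S.gateaux.sub_mid S.isOpen_prod [] [] ((0 : X), γ (u + t • x)) ((0 : X), γ u)
      (by simp; omega) hwt
    simp only [List.nil_append, Prod.smul_mk, smul_zero, Prod.mk_sub_mk, sub_zero, hL, map_smul,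
      map_sub, hγ u hu, hγ _ htU] at a1 a2
    rw [hδ, a1, a2]
  have e2 : δ - Δ = (lineDeriv ℝ h (u + t • x, ι (Φ (u + t • x))) (0, δ) -
      lineDeriv ℝ h (u + t • x, ι (Φ (u + t • x))) (0, Δ)) +
      (t⁻¹ • (A (u + t • x) - A u) + t⁻¹ • (lineDeriv ℝ h (u + t • x, ι (Φ (u + t • x))) (0, g u) -
        lineDeriv ℝ h (u, ι (Φ u)) (0, g u)) +
        lineDeriv ℝ h (u + t • x, ι (Φ (u + t • x))) (0, Δ) - Δ) := by
    have : δ = t⁻¹ • ((A (u + t • x) +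
        lineDeriv ℝ h (u + t • x, ι (Φ (u + t • x))) (0, g (u + t • x))) -
        (A u + lineDeriv ℝ h (u, ι (Φ u)) (0, g u))) := by
      rw [← hg u hu, ← hg _ htU]
    rw [e1, this]
    simp only [smul_sub, smul_add]
    abel
  exact (congrArg norm e2).trans_le (norm_add_le_of_le
    (norm_lineDeriv_sub_le_of_contraction S.contraction S.right_diff hwt _ _) le_rfl)

/-- Bounds on the derivatives of the solution of the linear equation `g = A + ∂_g h`. -/
theorem bddDeriv_solution [CompleteSpace Y] (S : ContractionStep n α c U ι h)
    (hα₀ : 0 ≤ α) (hα₁ : α < 1) (hc : 0 ≤ c) {K : ℝ} (hK : 1 ≤ K) {s : ℕ} (hΦ : DerivBdd U K s Φ)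
    (r : ℕ) (hr : r ≤ s + 1) (hn : r + 1 ≤ n) {A g : X → Y} {B : ℝ} (hB : 0 ≤ B)
    (hA : BddDeriv U B r A)
    (hg : ∀ u ∈ U, g u = A u + lineDeriv ℝ h (u, ι (Φ u)) (0, g u))
    (hγ : ∀ q, r = q + 1 → ∃ γ : X → Z, (∀ u ∈ U, ι (γ u) = g u) ∧ BddDeriv U K q γ) :
    BddDeriv U (solutionBound α c K r B) r g := by
  have hK0 : 0 ≤ K := by linarith
  induction r generalizing A g B with
  | zero =>
    exact fun u hu => norm_le_of_eq_add_of_contraction hα₁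
      (S.norm_lineDeriv_le (w := (u, ι (Φ u))) ⟨hu, trivial⟩) (hg u hu) (hA u hu)
  | succ r ih =>
    obtain ⟨γ, hγg, hγb⟩ := hγ r rfl
    have hB' : 0 ≤ B + formBound c K r 2 := add_nonneg hB (formBound_nonneg hc hK0 r 2)
    have hnn := solutionBound_nonneg hα₁ hc hK0 hB' r
    have h0 : 0 ≤ (1 - α)⁻¹ * B := mul_nonneg (inv_nonneg.2 (by linarith)) hB
    refine ⟨fun u hu => (norm_le_of_eq_add_of_contraction hα₁
      (S.norm_lineDeriv_le (w := (u, ι (Φ u))) ⟨hu, trivial⟩) (hg u hu) (hA.1 u hu)).trans ?_,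
      fun x hx => ?_⟩
    · simp only [solutionBound]; linarith
    have hd : ∀ u ∈ U, _ := fun u hu => S.exists_hasLineDerivAt_solution hα₀ hα₁ (by omega) hg hγg
      hu ((hΦ x hx).1 u hu) ((hA.2 x hx).1 u hu)
    refine ⟨fun u hu => (hd u hu).choose_spec.1.lineDifferentiableAt, ?_⟩
    have hform := S.bddDeriv_form hc hK hΦ r (by omega)
      [fun u => (0, γ u), fun u => (x, lineDeriv ℝ Φ u x)] (by simp) (by simp; omega) (by
        intro z hz
        simp only [List.mem_cons, List.not_mem_nil, or_false] at hz
        rcases hz with rfl | rfl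
        · exact hγb.const_prodMk S.isOpen (by simpa using hK0)
        · exact ((hΦ x hx).2.of_le (by omega)).const_prodMk S.isOpen (hx.trans hK))
    -- `∂_x g` solves the same kind of equation, with inhomogeneous term `∂_x A` plus a second-order
    -- form. Its lift `∂_x γ` is needed only if a further derivative remains.
    refine (ih (by omega) (by omega) hB' ((hA.2 x hx).2.add S.isOpen hform) ?_ ?_).mono ?_
    · intro u hu
      obtain ⟨Δ, h1, h2⟩ := hd u hu
      rw [h1.lineDeriv]; exact h2
    · rintro q rfl
      refine ⟨fun u => lineDeriv ℝ γ u x, fun u hu => ?_, (hγb.2 x hx).2⟩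
      have h1 : HasLineDerivAt ℝ (fun v => ι (γ v)) (ι (lineDeriv ℝ γ u x)) u x :=
        ι.hasFDerivAt.comp_hasDerivAt 0 ((hγb.2 x hx).1 u hu).hasLineDerivAt
      rw [← h1.lineDeriv]
      exact lineDeriv_congr_of_eqOn S.isOpen hγg hu x
    · simp only [solutionBound]; linarith

/-- Derivatives of the fixed point, one order higher and one space lower. -/
theorem derivBdd_succ [CompleteSpace Y] (S : ContractionStep n α c U ι h)
    (hα₀ : 0 ≤ α) (hα₁ : α < 1) (hc : 0 ≤ c) {K M : ℝ} (hK : 1 ≤ K) (hM : 0 ≤ M) {d : ℕ}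
    (hd : d + 2 ≤ n)
    (hleft : ∀ u ∈ U, ∀ (y : Y) (x : X), ‖lineDeriv ℝ h (u, y) (x, 0)‖ ≤ M * ‖x‖)
    {φ : X → Y} (hφ : ∀ u ∈ U, ι (Φ u) = φ u)
    (hder : ∀ u ∈ U, ∀ x : X, ∃ Δ, HasLineDerivAt ℝ φ Δ u x ∧
      Δ = lineDeriv ℝ h (u, φ u) (x, 0) + lineDeriv ℝ h (u, φ u) (0, Δ))
    (hΦ : DerivBdd U K d Φ) :
    DerivBdd U (solutionBound α c K (d + 1) (M + formBound c K d 2)) (d + 1) φ := by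
  have hK0 : 0 ≤ K := by linarith
  have hf := formBound_nonneg hc hK0 d 2
  intro x hx
  refine ⟨fun u hu => (hder u hu x).choose_spec.1.lineDifferentiableAt, ?_⟩
  have hL : (fun v => dirDeriv h ([(x, (0 : Z))].map (incr X ι)) (v, ι (Φ v))) =
      fun v => lineDeriv ℝ h (v, ι (Φ v)) (x, 0) := by
    funext v; simp [dirDeriv]
  -- The inhomogeneous term has degree 1, outside the range of `bddDeriv_form`. Its value is bounded
  -- by `M`, and one differentiation turns it into a form of degree 2.
  have hA : BddDeriv U (M + formBound c K d 2) (d + 1)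
      (fun v => lineDeriv ℝ h (v, ι (Φ v)) (x, 0)) := by
    refine ⟨fun u hu => (hleft u hu _ x).trans ?_, fun x' hx' => ?_⟩
    · nlinarith
    have hD : ∀ u ∈ U, _ := fun u hu => S.hasLineDerivAt_dirDeriv_const hu ((hΦ x' hx').1 u hu)
      [(x, (0 : Z))] (by simp) (by simp; omega)
    rw [hL] at hD
    refine ⟨fun u hu => (hD u hu).lineDifferentiableAt, ?_⟩
    have hform := S.bddDeriv_form hc hK hΦ d (by omega)
      [fun _ => (x, (0 : Z)), fun u => (x', lineDeriv ℝ Φ u x')] (by simp) (by simp; omega) (by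
        intro z hz
        simp only [List.mem_cons, List.not_mem_nil, or_false] at hz
        rcases hz with rfl | rfl
        · exact ((BddDeriv.zero S.isOpen).mono hK0).const_prodMk S.isOpen (hx.trans hK)
        · exact ((hΦ x' hx').2.of_le (by omega)).const_prodMk S.isOpen (hx'.trans hK))
    refine (hform.mono (le_add_of_nonneg_left hM)).congr S.isOpen fun u hu => ?_
    exact (hD u hu).lineDeriv.symm
  refine S.bddDeriv_solution hα₀ hα₁ hc hK hΦ (d + 1) le_rfl hd (by linarith) hA ?_ ?_
  · intro u hu
    obtain ⟨Δ, h1, h2⟩ := hder u hu x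
    rw [h1.lineDeriv, hφ u hu]; exact h2
  · intro q hq
    obtain rfl : d = q := by omega
    refine ⟨fun u => lineDeriv ℝ Φ u x, fun u hu => ?_, (hΦ x hx).2⟩
    have h1 : HasLineDerivAt ℝ (fun v => ι (Φ v)) (ι (lineDeriv ℝ Φ u x)) u x :=
      ι.hasFDerivAt.comp_hasDerivAt 0 ((hΦ x hx).1 u hu).hasLineDerivAt
    rw [← h1.lineDeriv]
    exact lineDeriv_congr_of_eqOn S.isOpen hφ hu x

end ContractionStep

end Step

/-- Bound for the derivatives of orders `1, …, d + 1` of the fixed point. -/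
noncomputable def fixedPointBound (α M c : ℝ) : ℕ → ℝ
  | 0 => max 1 ((1 - α)⁻¹ * M)
  | d + 1 => max (fixedPointBound α M c d)
      (solutionBound α c (fixedPointBound α M c d) (d + 1)
        (M + formBound c (fixedPointBound α M c d) d 2))

theorem fixedPointBound_mono (α M c : ℝ) : Monotone (fixedPointBound α M c) :=
  monotone_nat_of_le_succ fun _ => le_max_left _ _

/-- Needed so that one constant bounds both components of the increments `(x, ∂_x Φ)` with `‖x‖ ≤
1`. -/
theorem one_le_fixedPointBound (α M c : ℝ) (d : ℕ) : 1 ≤ fixedPointBound α M c d :=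
  (le_max_left _ _).trans (fixedPointBound_mono α M c (Nat.zero_le d))

/-! ### Induction along the scale of spaces. -/

section Scale

variable {X : Type u} [NormedAddCommGroup X] [NormedSpace ℝ X]
variable {Y : ℕ → Type v} [∀ k, NormedAddCommGroup (Y k)] [∀ k, NormedSpace ℝ (Y k)]
variable {n : ℕ} {α M : ℝ} {U : Set X} {incl : ∀ j k : ℕ, Y k →L[ℝ] Y j}
variable {h : ∀ k : ℕ, X × Y k → Y k}

theorem prod_norm_get {A : Type*} [SeminormedAddCommGroup A] (l : List A) :
    ∏ i, ‖l.get i‖ = (l.map norm).prod := by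
  rw [← ofFn_comp_get, List.prod_ofFn]

theorem DerivativeBounds.norm_left_le (B : DerivativeBounds n M U incl h)
    {k : ℕ} (hk : 1 ≤ k) (hkn : k ≤ n) {u : X} (hu : u ∈ U) (y : Y k) (x : X) :
    ‖lineDeriv ℝ (h k) (u, y) (x, 0)‖ ≤ M * ‖x‖ := by
  simpa [dirDeriv] using B.left k hk hkn 1 le_rfl (hk.trans hkn) u hu y fun _ => x

namespace ContractionScale

theorem left_diff (S : ContractionScale n α U incl h) {k : ℕ} (hk : 1 ≤ k) (hkn : k ≤ n)
    {w : X × Y k} (hw : w ∈ U ×ˢ (univ : Set (Y k))) (x : X) :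
    LineDifferentiableAt ℝ (h k) w (x, 0) :=
  ((S.gateaux_left k hk hkn).listGateaux.exists_deriv [x] (hk.trans hkn)).1 w hw

theorem right_diff (S : ContractionScale n α U incl h) {k : ℕ} (hk : 1 ≤ k) (hkn : k ≤ n)
    {w : X × Y k} (hw : w ∈ U ×ˢ (univ : Set (Y k))) (z : Y k) :
    LineDifferentiableAt ℝ (h k) w (0, z) :=
  (S.exists_mixed k hk hkn 0 (hk.trans hkn) 1 Fin.elim0 z).1 w hw

theorem right_cont (S : ContractionScale n α U incl h) {k : ℕ} (hk : 1 ≤ k) (hkn : k ≤ n) :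
    ContinuousOn (fun p : (X × Y k) × Y k => lineDeriv ℝ (h k) p.1 (0, p.2))
      ((U ×ˢ univ) ×ˢ univ) := by
  have h1 := S.continuousOn_mixed k hk hkn 0 (hk.trans hkn) 1
  have h2 : ContinuousOn (fun p : (X × Y k) × Y k => (p.1, ((Fin.elim0 : Fin 0 → X), p.2)))
      ((U ×ˢ univ) ×ˢ univ) := by fun_prop
  exact h1.comp h2 fun p hp => ⟨hp.1, trivial⟩

theorem contractionStep (S : ContractionScale n α U incl h) (B : DerivativeBounds n M U incl h)
    (hM : 0 ≤ M) {k : ℕ} (hk : 1 ≤ k) (hkn : k + 1 ≤ n) :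
    ContractionStep n α (2 ^ n * M) U (incl k (k + 1)) (h k) where
  isOpen := S.isOpen
  gateaux := (S.gateaux_prod k hk hkn).listGateaux
  bounded := by
    refine uniformlyBoundedDerivs_of_mixed hM S.isOpen (S.gateaux_prod k hk hkn).listGateaux ?_ ?_
    · intro xs h1 hn w hw y
      have := B.left k hk (by omega) xs.length h1 hn w hw y xs.get
      rwa [ofFn_comp_get (fun x : X => (x, (0 : Y k))), prod_norm_get] at this
    · intro xs zs h1 h2 hn w hw y
      have := B.mixed k hk hkn xs.length zs.length h1 h2 hn w hw y xs.get zs.get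
      rwa [ofFn_comp_get (fun x : X => (x, (0 : Y k))),
        ofFn_comp_get (fun z => ((0 : X), incl k (k + 1) z)), prod_norm_get, prod_norm_get] at this
  contraction := S.contraction k hk (by omega)
  right_diff := fun w hw z => S.right_diff hk (by omega) hw z
  right_cont := fun z =>
    (S.right_cont hk (by omega)).comp (f := fun w : X × Y k => (w, z)) (by fun_prop)
      fun w hw => ⟨hw, trivial⟩

/-- The fixed point takes values in all the spaces of the scale. -/
theorem exists_lift [∀ k, CompleteSpace (Y k)] (S : ContractionScale n α U incl h) (hα₀ : 0 ≤ α)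
    (hα₁ : α < 1) {φ : X → Y 1} (hφ : ∀ u ∈ U, h 1 (u, φ u) = φ u) {k : ℕ} (hk : 1 ≤ k)
    (hkn : k ≤ n) :
    ∃ ψ : X → Y k, (∀ u ∈ U, h k (u, ψ u) = ψ u) ∧ ∀ u ∈ U, incl 1 k (ψ u) = φ u := by
  have hex : ∀ u, ∃ y : Y k, u ∈ U → h k (u, y) = y := fun u => by
    by_cases hu : u ∈ U
    · obtain ⟨y, hy⟩ := exists_eq_add_of_contraction hα₀ hα₁ (S.contraction k hk hkn u hu)
      exact ⟨y, fun _ => hy.symm⟩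
    · exact ⟨0, fun hu' => absurd hu' hu⟩
  choose ψ hψ using hex
  refine ⟨ψ, hψ, fun u hu => ?_⟩
  -- The fixed point found in `Y k` is also one in `Y 1`, where fixed points are unique.
  refine eq_of_fixed_of_contraction hα₁ (S.contraction 1 le_rfl (hk.trans hkn) u hu) ?_ (hφ u hu)
  rw [← S.induced k hk hkn u hu, hψ u hu]

theorem exists_hasLineDerivAt [∀ k, CompleteSpace (Y k)] (S : ContractionScale n α U incl h)
    (hα₀ : 0 ≤ α) (hα₁ : α < 1) {k : ℕ} (hk : 1 ≤ k) (hkn : k ≤ n) {ψ : X → Y k}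
    (hψ : ∀ u ∈ U, h k (u, ψ u) = ψ u) {u : X} (hu : u ∈ U) (x : X) :
    ∃ Δ, HasLineDerivAt ℝ ψ Δ u x ∧
      Δ = lineDeriv ℝ (h k) (u, ψ u) (x, 0) + lineDeriv ℝ (h k) (u, ψ u) (0, Δ) :=
  exists_hasLineDerivAt_fixedPoint hα₀ hα₁ S.isOpen (S.contraction k hk hkn)
    (fun _ hw z => S.right_diff hk hkn hw z) (S.right_cont hk hkn) hψ hu
    (S.left_diff hk hkn ⟨hu, trivial⟩ x)

/-- Induction on `d` with `k` free: the step at level `k` uses the previous order at level `k + 1`,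
which `k + d ≤ n` allows. -/
theorem derivBdd_fixedPoint [∀ k, CompleteSpace (Y k)] (S : ContractionScale n α U incl h)
    (B : DerivativeBounds n M U incl h) (hα₀ : 0 ≤ α) (hα₁ : α < 1) (hM : 0 ≤ M) {φ : X → Y 1}
    (hφ : ∀ u ∈ U, h 1 (u, φ u) = φ u) (d : ℕ) {k : ℕ} (hk : 1 ≤ k) (hkn : k + d ≤ n)
    {ψ : X → Y k} (hψ : ∀ u ∈ U, h k (u, ψ u) = ψ u) (hψφ : ∀ u ∈ U, incl 1 k (ψ u) = φ u) :
    DerivBdd U (fixedPointBound α M (2 ^ n * M) d) d ψ := by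
  have hc : 0 ≤ 2 ^ n * M := by positivity
  induction d generalizing k with
  | zero =>
    intro x hx
    refine ⟨fun u hu => (S.exists_hasLineDerivAt hα₀ hα₁ hk (by omega) hψ hu x).choose_spec.1.lineDifferentiableAt, fun u hu => ?_⟩
    obtain ⟨Δ, h1, h2⟩ := S.exists_hasLineDerivAt hα₀ hα₁ hk (by omega) hψ hu x
    have hL := norm_lineDeriv_le_of_contraction (S.contraction k hk (by omega))
      (fun w hw z => S.right_diff hk (by omega) hw z)
      (⟨hu, trivial⟩ : (u, ψ u) ∈ U ×ˢ (univ : Set (Y k)))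
    change ‖lineDeriv ℝ ψ u x‖ ≤ _
    rw [h1.lineDeriv]
    refine (norm_le_of_eq_add_of_contraction hα₁ hL h2 (K := M) ?_).trans (le_max_right _ _)
    exact (B.norm_left_le hk (by omega) hu _ x).trans (mul_le_of_le_one_right hM hx)
  | succ d ih =>
    obtain ⟨Φ, hΦ, hΦφ⟩ := S.exists_lift hα₀ hα₁ hφ (k := k + 1) (by omega) (by omega)
    have hΦb := ih (k := k + 1) (by omega) (by omega) hΦ hΦφ
    have hincl : ∀ u ∈ U, incl k (k + 1) (Φ u) = ψ u := fun u hu => by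
      apply S.scale.injective 1 k le_rfl hk (by omega)
      rw [S.scale.trans 1 k (k + 1) le_rfl hk (by omega) (by omega), hΦφ u hu, hψφ u hu]
    exact ((S.contractionStep B hM hk (by omega)).derivBdd_succ hα₀ hα₁ hc
      (one_le_fixedPointBound _ _ _ d) hM (by omega)
      (fun u hu y x => B.norm_left_le hk (by omega) hu y x) hincl
      (fun u hu x => S.exists_hasLineDerivAt hα₀ hα₁ hk (by omega) hψ hu x) hΦb).mono
        (le_max_right _ _)

end ContractionScale

end Scale

theorem corollary2p13 (n : ℕ) (hn : 1 ≤ n) (α : ℝ) (hα₀ : 0 ≤ α) (hα₁ : α < 1)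
    (M : ℝ) (hM : 0 < M) :
    ∃ C : ℝ,
      ∀ (X : Type u) [NormedAddCommGroup X] [NormedSpace ℝ X] [CompleteSpace X]
        (Y : ℕ → Type v) [∀ k, NormedAddCommGroup (Y k)] [∀ k, NormedSpace ℝ (Y k)]
        [∀ k, CompleteSpace (Y k)]
        (U : Set X) (incl : ∀ j k : ℕ, Y k →L[ℝ] Y j) (h : ∀ k : ℕ, X × Y k → Y k),
        ContractionScale n α U incl h →
        DerivativeBounds n M U incl h →
        ∀ φ : X → Y 1, (∀ w ∈ U, h 1 (w, φ w) = φ w) →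
        ∀ k, 1 ≤ k → k ≤ n →
          ∃ ψ : X → Y (n - k + 1),
            (∀ w ∈ U, incl 1 (n - k + 1) (ψ w) = φ w) ∧
            (∀ x : Fin k → X, DirDiffOn U ψ (List.ofFn x)) ∧
            ∀ w ∈ U, ∀ x : Fin k → X, (∀ l, ‖x l‖ = 1) →
              ‖dirDeriv ψ (List.ofFn x) w‖ ≤ C := by
  -- Order `k` needs only the index `k - 1` at level `n - k + 1`; by monotonicity the index `n`
  -- serves all `k` at once.
  refine ⟨fixedPointBound α M (2 ^ n * M) n, ?_⟩
  intro X _ _ _ Y _ _ _ U incl h S B φ hφ k hk hkn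
  obtain ⟨ψ, hψ, hψφ⟩ := S.exists_lift hα₀ hα₁ hφ (k := n - k + 1) (by omega) (by omega)
  have hb := S.derivBdd_fixedPoint B hα₀ hα₁ hM.le hφ (k - 1) (by omega) (by omega) hψ hψφ
  have hlen : ∀ x : Fin k → X, (List.ofFn x).length = k - 1 + 1 := fun x => by simp; omega
  refine ⟨ψ, hψφ, fun x => hb.dirDiffOn S.isOpen (hlen x), fun w hw x hx => ?_⟩
  refine (hb.norm_dirDeriv_le (hlen x) (fun y hy => ?_) hw).trans
    (fixedPointBound_mono _ _ _ (by omega))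
  obtain ⟨l, rfl⟩ := (List.mem_ofFn' _ _).1 hy
  exact (hx l).le
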